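/- Let $d\ge 1$ be an integer and $\delta\in(0,\frac12]$. For $n\in\mathbb N$ let $\mathrm{Sym}^n(\mathbb C^d)\subseteq(\mathbb C^d)^{\otimes n}$ be the symmetric subspace, $\Pi_n:(\mathbb C^d)^{\otimes n}\to\mathrm{Sym}^n(\mathbb C^d)$ the orthogonal projection, $|0\rangle,\dots,|d-1\rangle$ the standard basis of $\mathbb C^d$, and define the blurring map on linear operators $X$ on $\mathrm{Sym}^n(\mathbb C^d)$ by \[ B_{n,\delta}(X)=\Pi_n\Big(\mathrm{Tr}_{\lfloor\delta n\rfloor}\,\mathcal S_{n+\lfloor\delta n\rfloor}\big(\Pi_n^\dagger X\Pi_n\otimes|0\rangle\langle0|^{\otimes\lfloor\delta n\rfloor}\big)\Big)\Pi_n^\dagger ,\qquad \mathcal S_N(Y)=\frac1{N!}\sum_{\pi\in S_N}U_\pi YU_\pi^\dagger , \] where $U_\pi$ permutes the $N$ tensor factors and $\mathrm{Tr}_r$ is the partial trace over the last $r$ factors. For $t\in\mathbb N^{d}$ with $t_0+\dots+t_{d-1}=n$ let $|n,t\rangle\in\mathrm{Sym}^n(\mathbb C^d)$ be the normalised sum of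 all basis strings $|x_1\dots x_n\rangle$ in which each symbol $x\in\{0,\dots,d-1\}$ occurs $t_x$ times, and let $U_n$ be the isometry from $\mathrm{Sym}^n(\mathbb C^d)$ into the $(d-1)$-mode Fock space $\mathcal H_{d-1}=\ell^2(\mathbb N)^{\otimes(d-1)}$ with $U_n|n,t\rangle=|t_1,\dots,t_{d-1}\rangle$. Define the lifted blurring map on trace class operators on $\mathcal H_{d-1}$ by \[ \widetilde B_{n,\delta}(X)=U_nB_{n,\delta}(U_n^\dagger XU_n)U_n^\dagger . \] On trace class operators on $\ell^2(\mathbb N)$, with annihilation operator $a|k\rangle=\sqrt k\,|k-1\rangle$, let \[ \mathcal E_\lambda(X)=\sum_{j=0}^\infty\frac1{j!}\Big(\frac1\lambda-1\Big)^j a^j\lambda^{a^\dagger a/2}X\lambda^{a^\dagger a/2}(a^\dagger)^j\quad(0<\lambda<1),\qquad \mathcal D_\mu(X)=\mu^{a^\dagger a}X\mu^{a^\dagger a}\quad(0\le\mu\le1) \] ($\mathcal E_\lambda$ is the pure loss channel of transmissivity $\lambda$), and put \[ \lambda(\delta)=\frac1{1+\delta(1+\delta)},\qquad \mu(\delta)=\frac{\sqrt{1+\delta(1+\delta)}}{1+\delta}.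 \] Let $(\mathcal E_{\lambda(\delta)}\circ\mathcal D_{\mu(\delta)})^{\otimes(d-1)}$ be the trace-norm bounded linear map on the trace class operators on $\mathcal H_{d-1}$ that sends $X_1\otimes\dots\otimes X_{d-1}$ to $\bigotimes_i\mathcal E_{\lambda(\delta)}(\mathcal D_{\mu(\delta)}(X_i))$ for all trace class $X_i$; this map exists. Then for every trace class operator $X$ on $\mathcal H_{d-1}$ (in particular for every density operator) \[ \lim_{n\to\infty}\Big\|\widetilde B_{n,\delta}(X)-\big(\mathcal E_{\lambda(\delta)}\circ\mathcal D_{\mu(\delta)}\big)^{\otimes(d-1)}(X)\Big\|_1=0 . \] -/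

import Mathlib

open Filter Topology
open scoped ENNReal InnerProductSpace

namespace Blurring

noncomputable section

/-! ### Trace class operators on `ℓ²(ι)` -/

/-- The Hilbert space `ℓ²(ι)`. For `ι = ℕ` this is the space of one bosonic mode. -/
def Hilb (ι : Type) : Type := lp (fun _ : ι => ℂ) 2

instance (ι : Type) : NormedAddCommGroup (Hilb ι) :=
  inferInstanceAs (NormedAddCommGroup (lp (fun _ : ι => ℂ) 2))

instance (ι : Type) : InnerProductSpace ℂ (Hilb ι) :=
  inferInstanceAs (InnerProductSpace ℂ (lp (fun _ : ι => ℂ) 2))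

instance (ι : Type) : CompleteSpace (Hilb ι) :=
  inferInstanceAs (CompleteSpace (lp (fun _ : ι => ℂ) 2))

/-- The coefficients of a vector of `ℓ²(ι)`. -/
def coeff {ι : Type} (v : Hilb ι) : ι → ℂ := Subtype.val (p := fun f => f ∈ lp (fun _ : ι => ℂ) 2) v

/-- Bounded operators on `ℓ²(ι)`. -/
abbrev Op (ι : Type) : Type := Hilb ι →L[ℂ] Hilb ι

/-- The canonical basis vector `|k⟩` of `ℓ²(ι)`. -/
def ket {ι : Type} [DecidableEq ι] (k : ι) : Hilb ι :=
  (lp.single 2 k (1 : ℂ) : lp (fun _ : ι => ℂ) 2)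

/-- The trace norm `‖X‖₁ = Tr |X| = ∑ₖ ⟨k| |X| |k⟩`, where `|X| = √(X† X)`, with values
in `[0, ∞]`. -/
def traceNorm {ι : Type} [DecidableEq ι] (X : Op ι) : ℝ≥0∞ :=
  ∑' k : ι, ENNReal.ofReal (⟪ket k, CFC.abs X (ket k)⟫_ℂ).re

/-- `X` is a trace class operator. -/
def IsTraceClass {ι : Type} [DecidableEq ι] (X : Op ι) : Prop := traceNorm X ≠ ∞

/-- Strong convergence `Λₙ → Λ` of maps on the trace class operators: `‖Λₙ(X) - Λ(X)‖₁ → 0` for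
every trace class `X` (in particular for every density operator). That the maps send trace class
operators to trace class operators is part of the definition. -/
def StronglyConverges {ι : Type} [DecidableEq ι] (Λs : ℕ → Op ι → Op ι) (Λ : Op ι → Op ι) : Prop :=
  ∀ X : Op ι, IsTraceClass X →
    (∀ n, IsTraceClass (Λs n X)) ∧ IsTraceClass (Λ X) ∧
      Tendsto (fun n => traceNorm (Λs n X - Λ X)) atTop (𝓝 0)

/-! ### Tensor products over the modes -/

/-- The `m`-mode Fock space `ℓ²(ℕ)^{⊗ m}`, with orthonormal basis the Fock states
`|k₁, …, kₘ⟩ = |k₁⟩ ⊗ ⋯ ⊗ |kₘ⟩`. -/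
abbrev Fock (m : ℕ) : Type := Hilb (Fin m → ℕ)

/-- `Y = X₁ ⊗ ⋯ ⊗ Xₘ`: the bounded operator `Y` is the one with matrix elements
`⟨h|Y|k⟩ = ∏ᵢ ⟨hᵢ|Xᵢ|kᵢ⟩`. -/
def IsTensorProduct {m : ℕ} (X : Fin m → Op ℕ) (Y : Op (Fin m → ℕ)) : Prop :=
  ∀ h k : Fin m → ℕ, ⟪ket h, Y (ket k)⟫_ℂ = ∏ i, ⟪ket (h i), X i (ket (k i))⟫_ℂ

/-- `Φ = Λ^{⊗ m}`: on trace class operators, `Φ` is the trace-norm bounded linear map that satisfies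
`Φ(X₁ ⊗ ⋯ ⊗ Xₘ) = Λ(X₁) ⊗ ⋯ ⊗ Λ(Xₘ)`. -/
structure IsTensorPower (m : ℕ) (Λ : Op ℕ → Op ℕ)
    (Φ : Op (Fin m → ℕ) → Op (Fin m → ℕ)) : Prop where
  map_add : ∀ X Y, IsTraceClass X → IsTraceClass Y → Φ (X + Y) = Φ X + Φ Y
  map_smul : ∀ (c : ℂ) (X), IsTraceClass X → Φ (c • X) = c • Φ X
  bounded : ∃ C : NNReal, ∀ X, IsTraceClass X → traceNorm (Φ X) ≤ C * traceNorm X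
  map_tensor : ∀ (X : Fin m → Op ℕ) (Y : Op (Fin m → ℕ)), (∀ i, IsTraceClass (X i)) →
    IsTensorProduct X Y → IsTensorProduct (fun i => Λ (X i)) (Φ Y)

/-! ### The pure loss channel and the damping map on one mode -/

/-- The annihilation operator on coefficient sequences: `a|k⟩ = √k |k-1⟩`, that is
`(a v)ⱼ = √(j+1) v_{j+1}`. -/
def annihilation : Module.End ℂ (ℕ → ℂ) where
  toFun v := fun j => (Real.sqrt (j + 1) : ℂ) * v (j + 1)
  map_add' v w := by ext j; simp [mul_add]
  map_smul' c v := by ext j; simp; ring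

/-- The operator `c^{a†a}` on coefficient sequences: `c^{a†a}|k⟩ = c^k |k⟩`. -/
def powNumber (c : ℝ) : Module.End ℂ (ℕ → ℂ) where
  toFun v := fun j => (c : ℂ) ^ j * v j
  map_add' v w := by ext j; simp [mul_add]
  map_smul' c v := by ext j; simp; ring

open Classical in
/-- The bounded operator on `ℓ²(ℕ)` that acts as `T` on coefficient sequences (and `0` if there is
no such operator). -/
def boundedOp (T : Module.End ℂ (ℕ → ℂ)) : Op ℕ :=
  if h : ∃ K : Op ℕ, ∀ (v : Hilb ℕ) (j : ℕ), coeff (K v) j = T (coeff v) j then h.choose else 0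

/-- The bounded operator `a^n λ^{a†a/2}`. -/
def lossOp (lam : ℝ) (n : ℕ) : Op ℕ := boundedOp (annihilation ^ n * powNumber (Real.sqrt lam))

/-- The pure loss channel
`E_λ(X) = ∑ₙ (1/n!) (1/λ - 1)^n a^n λ^{a†a/2} X λ^{a†a/2} (a†)^n`. -/
def pureLoss (lam : ℝ) (X : Op ℕ) : Op ℕ :=
  ∑' n : ℕ, (((1 / (n.factorial : ℝ)) * (1 / lam - 1) ^ n : ℝ) : ℂ) •
    (lossOp lam n ∘L X ∘L ContinuousLinearMap.adjoint (lossOp lam n))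

/-- The damping map `D_μ(X) = μ^{a†a} X μ^{a†a}`. -/
def damping (mu : ℝ) (X : Op ℕ) : Op ℕ :=
  boundedOp (powNumber mu) ∘L X ∘L boundedOp (powNumber mu)

/-- `λ(δ) = 1 / (1 + δ(1+δ))`. -/
def lamParam (δ : ℝ) : ℝ := 1 / (1 + δ * (1 + δ))

/-- `μ(δ) = √(1 + δ(1+δ)) / (1 + δ)`. -/
def muParam (δ : ℝ) : ℝ := Real.sqrt (1 + δ * (1 + δ)) / (1 + δ)

/-! ### The blurring map on `(ℂ^d)^{⊗ n}` and on its symmetric subspace -/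

/-- The space `(ℂ^d)^{⊗ n}`, with orthonormal basis the strings `|x₁ … xₙ⟩`. -/
abbrev TensorSpace (d n : ℕ) : Type := EuclideanSpace ℂ (Fin n → Fin d)

/-- Linear operators on `(ℂ^d)^{⊗ n}`, as matrices in the basis of strings. -/
abbrev TensorMat (d n : ℕ) : Type := Matrix (Fin n → Fin d) (Fin n → Fin d) ℂ

/-- The unitary `U_π` that permutes the tensor factors: `U_π |x⟩ = |x ∘ π⁻¹⟩`. -/
def permUnitary (d : ℕ) {N : ℕ} (π : Equiv.Perm (Fin N)) : TensorMat d N :=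
  Matrix.of fun x y => if x = y ∘ ⇑π⁻¹ then 1 else 0

/-- The symmetrisation map `S_N(X) = (1/N!) ∑_π U_π X U_π†`. -/
def symmetrise {d N : ℕ} (X : TensorMat d N) : TensorMat d N :=
  ((N.factorial : ℂ)⁻¹) •
    ∑ π : Equiv.Perm (Fin N), permUnitary d π * X * (permUnitary d π).conjTranspose

/-- The tensor product of an operator on `n` copies and one on `r` copies. -/
def tensorMat {d n r : ℕ} (X : TensorMat d n) (Y : TensorMat d r) : TensorMat d (n + r) :=
  Matrix.of fun x y =>
    X (fun i => x (Fin.castAdd r i)) (fun i => y (Fin.castAdd r i)) *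
      Y (fun i => x (Fin.natAdd n i)) (fun i => y (Fin.natAdd n i))

/-- The tensor power `ρ^{⊗ r}`. -/
def tensorPowMat {d : ℕ} (ρ : Matrix (Fin d) (Fin d) ℂ) (r : ℕ) : TensorMat d r :=
  Matrix.of fun x y => ∏ i, ρ (x i) (y i)

/-- The partial trace over the last `r` copies. -/
def partialTrace {d n r : ℕ} (X : TensorMat d (n + r)) : TensorMat d n :=
  Matrix.of fun x y => ∑ z : Fin r → Fin d, X (Fin.append x z) (Fin.append y z)

/-- The blurring map with respect to `ρ`:
`X ↦ Tr_{⌊δn⌋} S_{n+⌊δn⌋}(X ⊗ ρ^{⊗ ⌊δn⌋})`. -/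
def blurringFull {d : ℕ} (ρ : Matrix (Fin d) (Fin d) ℂ) (n : ℕ) (δ : ℝ) (X : TensorMat d n) :
    TensorMat d n :=
  partialTrace (r := ⌊δ * n⌋₊) (symmetrise (tensorMat X (tensorPowMat ρ ⌊δ * n⌋₊)))

/-- The symmetric subspace `Sym^n(ℂ^d)` of `(ℂ^d)^{⊗ n}`. -/
def symSpace (d n : ℕ) : Submodule ℂ (TensorSpace d n) where
  carrier := {v | ∀ π : Equiv.Perm (Fin n), Matrix.toEuclideanCLM (𝕜 := ℂ) (permUnitary d π) v = v}
  add_mem' hv hw π := by rw [map_add, hv π, hw π]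
  zero_mem' π := map_zero _
  smul_mem' c v hv π := by rw [map_smul, hv π]

/-- The orthogonal projection `Π_n : (ℂ^d)^{⊗ n} → Sym^n(ℂ^d)`; its adjoint `Π_n†` is the
inclusion. -/
def symProj (d n : ℕ) : TensorSpace d n →L[ℂ] symSpace d n := (symSpace d n).orthogonalProjectionOnto

/-- The blurring map on `L(Sym^n(ℂ^d))`, `d = m + 1`, for the pure state `|0⟩⟨0|`:
`B_{n,δ}(X) = Π_n (Tr_{⌊δn⌋} S_{n+⌊δn⌋}(X ⊗ |0⟩⟨0|^{⊗ ⌊δn⌋})) Π_n†`, where `X` is regarded as the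
operator `Π_n† X Π_n` on `(ℂ^d)^{⊗ n}`. -/
def blurring (m n : ℕ) (δ : ℝ) (X : symSpace (m + 1) n →L[ℂ] symSpace (m + 1) n) :
    symSpace (m + 1) n →L[ℂ] symSpace (m + 1) n :=
  symProj (m + 1) n ∘L
    Matrix.toEuclideanCLM (𝕜 := ℂ)
      (blurringFull (Matrix.single 0 0 1) n δ
        ((Matrix.toEuclideanCLM (n := Fin n → Fin (m + 1)) (𝕜 := ℂ)).symm
          ((symSpace (m + 1) n).subtypeL ∘L X ∘L symProj (m + 1) n))) ∘L
    (symSpace (m + 1) n).subtypeL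

/-! ### The embedding of the symmetric subspace into Fock space -/

/-- The unnormalised type of a string: the number of occurrences of each symbol. -/
def typeOf {d n : ℕ} (x : Fin n → Fin d) : Fin d → ℕ :=
  fun a => (Finset.univ.filter fun i => x i = a).card

/-- The set of unnormalised `n`-types: vectors of `d` natural numbers with sum `n`. -/
def types (d n : ℕ) : Finset (Fin d → ℕ) := Finset.piAntidiag Finset.univ n

/-- The type class of `t`: the strings with type `t`. -/
def typeClass {d : ℕ} (n : ℕ) (t : Fin d → ℕ) : Finset (Fin n → Fin d) :=
  Finset.univ.filter fun x => typeOf x = t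

/-- The vector `|n,t⟩ = |T_{n,t}|^{-1/2} ∑_{x ∈ T_{n,t}} |x⟩` of the type basis. -/
def typeKet {d : ℕ} (n : ℕ) (t : Fin d → ℕ) : TensorSpace d n :=
  ((Real.sqrt (typeClass n t).card : ℂ)⁻¹) •
    ∑ x ∈ typeClass n t, EuclideanSpace.single x (1 : ℂ)

theorem typeOf_mem_types {d n : ℕ} (x : Fin n → Fin d) : typeOf x ∈ types d n := by
  simp only [types, Finset.mem_piAntidiag, typeOf]
  refine ⟨?_, by simp⟩
  have := Finset.card_eq_sum_card_fiberwise (f := x) (s := Finset.univ) (t := Finset.univ)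
    (by intro i _; simp)
  simp only [Finset.card_univ, Fintype.card_fin] at this
  exact this.symm

theorem exists_perm_of_typeOf_eq {d n : ℕ} {x y : Fin n → Fin d} (h : typeOf x = typeOf y) :
    ∃ π : Equiv.Perm (Fin n), x = y ∘ π := by
  have key : ∀ a, Nonempty ({i // x i = a} ≃ {i // y i = a}) := by
    intro a
    have := congrFun h a
    simp only [typeOf] at this
    exact ⟨Fintype.equivOfCardEq (by simpa [Fintype.card_subtype] using this)⟩
  have e : ∀ a, {i // x i = a} ≃ {i // y i = a} := fun a => (key a).some
  refine ⟨Equiv.ofFiberEquiv e, ?_⟩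
  funext i
  exact (Equiv.ofFiberEquiv_map e i).symm

theorem permUnitary_apply {d n : ℕ} (π : Equiv.Perm (Fin n)) (v : TensorSpace d n)
    (x : Fin n → Fin d) :
    Matrix.toEuclideanCLM (𝕜 := ℂ) (permUnitary d π) v x = v (x ∘ π) := by
  have h : ∀ y : Fin n → Fin d, (x = y ∘ ⇑π⁻¹) ↔ (x ∘ π = y) := by
    intro y
    constructor
    · rintro rfl; ext i; simp
    · rintro rfl; ext i; simp
  simp only [Matrix.ofLp_toEuclideanCLM, Matrix.mulVec, dotProduct, permUnitary, Matrix.of_apply, h]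
  simp

theorem symSpace_apply_eq {d n : ℕ} (v : symSpace d n) {x y : Fin n → Fin d}
    (h : typeOf x = typeOf y) : (v : TensorSpace d n) x = (v : TensorSpace d n) y := by
  obtain ⟨π, rfl⟩ := exists_perm_of_typeOf_eq h
  rw [← permUnitary_apply π, v.2 π]

theorem norm_inner_typeKet_sq {d n : ℕ} (v : symSpace d n) (t : Fin d → ℕ) :
    ‖⟪typeKet n t, (v : TensorSpace d n)⟫_ℂ‖ ^ 2 =
      ∑ x ∈ typeClass n t, ‖(v : TensorSpace d n) x‖ ^ 2 := by
  have h1 : ⟪typeKet n t, (v : TensorSpace d n)⟫_ℂ =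
      ((Real.sqrt (typeClass n t).card : ℂ)⁻¹) *
        ∑ x ∈ typeClass n t, (v : TensorSpace d n) x := by
    simp [typeKet, EuclideanSpace.inner_single_left, mul_comm]
  rw [h1]
  rcases (typeClass n t).eq_empty_or_nonempty with h0 | ⟨y, hy⟩
  · simp [h0]
  have hc : ∀ x ∈ typeClass n t, (v : TensorSpace d n) x = (v : TensorSpace d n) y := by
    intro x hx
    apply symSpace_apply_eq
    simp only [typeClass, Finset.mem_filter, Finset.mem_univ, true_and] at hx hy
    rw [hx, hy]
  rw [Finset.sum_congr rfl hc,
    Finset.sum_congr rfl (fun x hx => by rw [hc x hx] :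
      ∀ x ∈ typeClass n t, ‖(v : TensorSpace d n) x‖ ^ 2 = ‖(v : TensorSpace d n) y‖ ^ 2)]
  have hpos : (0 : ℝ) < (typeClass n t).card := by exact_mod_cast Finset.card_pos.mpr ⟨y, hy⟩
  simp only [Finset.sum_const, nsmul_eq_mul, norm_mul, norm_inv, Complex.norm_real, mul_pow,
    inv_pow, Complex.norm_natCast, Real.norm_eq_abs, sq_abs, Real.sq_sqrt hpos.le]
  field_simp

theorem norm_sq_eq_sum_types {d n : ℕ} (v : symSpace d n) :
    ‖v‖ ^ 2 = ∑ t ∈ types d n, ‖⟪typeKet n t, (v : TensorSpace d n)⟫_ℂ‖ ^ 2 := by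
  simp only [norm_inner_typeKet_sq]
  rw [Submodule.coe_norm, EuclideanSpace.norm_sq_eq]
  rw [← Finset.sum_fiberwise_of_maps_to (s := Finset.univ) (t := types d n) (g := typeOf)
    (fun x _ => typeOf_mem_types x)]
  rfl

theorem tail_injOn_types (m n : ℕ) : Set.InjOn (Fin.tail (α := fun _ : Fin (m + 1) => ℕ))
    (types (m + 1) n : Set (Fin (m + 1) → ℕ)) := by
  intro s hs t ht hst
  simp only [types, Finset.mem_coe, Finset.mem_piAntidiag, Fin.sum_univ_succ] at hs ht
  have h : ∀ i : Fin m, s i.succ = t i.succ := fun i => congrFun hst i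
  have h0 : s 0 = t 0 := by
    have h1 := hs.1
    have h2 := ht.1
    rw [Finset.sum_congr rfl (fun i _ => h i)] at h1
    omega
  ext i
  exact Fin.cases h0 h i

theorem orthonormal_ket {ι : Type} [DecidableEq ι] : Orthonormal ℂ (ket : ι → Hilb ι) := by
  rw [orthonormal_iff_ite]
  intro i j
  refine (lp.inner_single_left (𝕜 := ℂ) i (1 : ℂ) (ket j : Hilb ι)).trans ?_
  simp only [ket, lp.single_apply, Pi.single_apply]
  split_ifs <;> simp

/-- The isometry `U_n : Sym^n(ℂ^{m+1}) → ℋ_m`,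
`U_n |n,t⟩ = |n t(1), …, n t(m)⟩` on the type basis, that is `U_n = ∑_t |t(1), …, t(m)⟩⟨n,t|`, the
sum being over unnormalised types. -/
def embedding (m n : ℕ) : symSpace (m + 1) n →ₗᵢ[ℂ] Fock m where
  toFun v := ∑ t ∈ types (m + 1) n,
    ⟪typeKet n t, (v : TensorSpace (m + 1) n)⟫_ℂ • ket (Fin.tail t)
  map_add' v w := by simp [add_smul, Finset.sum_add_distrib]
  map_smul' c v := by simp [mul_smul, Finset.smul_sum]
  norm_map' v := by
    have h : ‖∑ t ∈ types (m + 1) n,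
        ⟪typeKet n t, (v : TensorSpace (m + 1) n)⟫_ℂ • (ket (Fin.tail t) : Fock m)‖ ^ 2
        = ‖v‖ ^ 2 := by
      rw [norm_sq_eq_sum_types, ← Finset.sum_coe_sort (types (m + 1) n),
        ← Finset.sum_coe_sort (types (m + 1) n)]
      have ho : Orthonormal ℂ
          (fun t : types (m + 1) n => (ket (Fin.tail t.1) : Fock m)) :=
        orthonormal_ket.comp (fun t : types (m + 1) n => Fin.tail t.1)
          (fun s t hst => Subtype.ext (tail_injOn_types m n s.2 t.2 hst))
      have := ho.inner_sum
        (fun t => ⟪typeKet n t.1, (v : TensorSpace (m + 1) n)⟫_ℂ)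
        (fun t => ⟪typeKet n t.1, (v : TensorSpace (m + 1) n)⟫_ℂ) Finset.univ
      rw [inner_self_eq_norm_sq_to_K] at this
      simp only [RCLike.conj_mul] at this
      exact_mod_cast this
    exact (sq_eq_sq₀ (norm_nonneg _) (norm_nonneg _)).mp h

/-- The lifted blurring map `X ↦ U_n B_{n,δ}(U_n† X U_n) U_n†` on operators on `ℋ_m`. -/
def liftedBlurring (m n : ℕ) (δ : ℝ) (X : Op (Fin m → ℕ)) : Op (Fin m → ℕ) :=
  let U : symSpace (m + 1) n →L[ℂ] Fock m := (embedding m n).toContinuousLinearMap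
  let Uadj : Fock m →L[ℂ] symSpace (m + 1) n :=
    ContinuousLinearMap.adjoint (𝕜 := ℂ) (E := symSpace (m + 1) n) (F := Fock m) U
  U ∘L blurring m n δ (Uadj ∘L X ∘L U) ∘L Uadj

/-! ### The operators `a^n λ^{a†a/2}` and `μ^{a†a}` are bounded -/

theorem exists_weighted_shift (w : ℕ → ℂ) (C : ℝ) (hw : ∀ j, ‖w j‖ ≤ C) (n : ℕ) :
    ∃ K : Op ℕ, ∀ (v : Hilb ℕ) (j : ℕ), coeff (K v) j = w j * coeff v (j + n) := by
  have hC : 0 ≤ C := (norm_nonneg _).trans (hw 0)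
  have hp : (0 : ℝ) < (2 : ℝ≥0∞).toReal := by simp
  have hs : ∀ v : Hilb ℕ, Summable fun j => ‖coeff v (j + n)‖ ^ (2 : ℝ≥0∞).toReal := fun v =>
    (summable_nat_add_iff n).mpr ((lp.memℓp v).summable hp)
  have hle : ∀ (v : Hilb ℕ) (j : ℕ), ‖w j * coeff v (j + n)‖ ^ (2 : ℝ≥0∞).toReal ≤
      C ^ (2 : ℝ≥0∞).toReal * ‖coeff v (j + n)‖ ^ (2 : ℝ≥0∞).toReal := by
    intro v j
    rw [norm_mul, Real.mul_rpow (norm_nonneg _) (norm_nonneg _)]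
    gcongr
    exact hw j
  have hmem : ∀ v : Hilb ℕ, Memℓp (fun j => w j * coeff v (j + n)) 2 := fun v =>
    memℓp_gen (Summable.of_nonneg_of_le (fun j => by positivity) (hle v)
      ((hs v).mul_left _))
  let L : Hilb ℕ →ₗ[ℂ] Hilb ℕ :=
    { toFun := fun v => ⟨fun j => w j * coeff v (j + n), hmem v⟩
      map_add' := fun u v => Subtype.ext (funext fun j => mul_add _ _ _)
      map_smul' := fun c v => Subtype.ext (funext fun j => mul_left_comm _ _ _) }
  refine ⟨L.mkContinuous C fun v => ?_, fun v j => rfl⟩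
  refine lp.norm_le_of_tsum_le hp (by positivity) ?_
  rw [Real.mul_rpow hC (norm_nonneg _)]
  refine le_of_le_of_eq ?_ (congrArg (C ^ (2 : ℝ≥0∞).toReal * ·) (lp.norm_rpow_eq_tsum hp v).symm)
  calc ∑' j, ‖w j * coeff v (j + n)‖ ^ (2 : ℝ≥0∞).toReal
      ≤ ∑' j, C ^ (2 : ℝ≥0∞).toReal * ‖coeff v (j + n)‖ ^ (2 : ℝ≥0∞).toReal :=
        Summable.tsum_le_tsum (hle v) (Summable.of_nonneg_of_le (fun j => by positivity) (hle v)
          ((hs v).mul_left _)) ((hs v).mul_left _)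
    _ = C ^ (2 : ℝ≥0∞).toReal * ∑' j, ‖coeff v (j + n)‖ ^ (2 : ℝ≥0∞).toReal := tsum_mul_left
    _ ≤ _ := by
        refine mul_le_mul_of_nonneg_left ?_ (by positivity)
        have h := ((lp.memℓp v).summable hp).sum_add_tsum_nat_add n
        have h0 : 0 ≤ ∑ i ∈ Finset.range n, ‖coeff v i‖ ^ (2 : ℝ≥0∞).toReal :=
          Finset.sum_nonneg fun i _ => by positivity
        exact le_of_le_of_eq (le_add_of_nonneg_left h0) h

theorem boundedOp_apply {T : Module.End ℂ (ℕ → ℂ)}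
    (h : ∃ K : Op ℕ, ∀ (v : Hilb ℕ) (j : ℕ), coeff (K v) j = T (coeff v) j) (v : Hilb ℕ) (j : ℕ) :
    coeff (boundedOp T v) j = T (coeff v) j := by
  rw [boundedOp, dif_pos h]
  exact h.choose_spec v j

theorem boundedOp_powNumber_apply {mu : ℝ} (h0 : 0 ≤ mu) (h1 : mu ≤ 1) (v : Hilb ℕ) (j : ℕ) :
    coeff (boundedOp (powNumber mu) v) j = (mu : ℂ) ^ j * coeff v j := by
  refine boundedOp_apply ?_ v j
  obtain ⟨K, hK⟩ := exists_weighted_shift (fun j => (mu : ℂ) ^ j) 1 (fun j => by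
    rw [norm_pow, Complex.norm_real, Real.norm_eq_abs, abs_of_nonneg h0]
    exact pow_le_one₀ h0 h1) 0
  exact ⟨K, fun v j => by rw [hK]; rfl⟩

theorem annihilation_pow_apply (n : ℕ) (v : ℕ → ℂ) (j : ℕ) :
    (annihilation ^ n) v j = (Real.sqrt ((j + n).descFactorial n) : ℂ) * v (j + n) := by
  induction n generalizing v with
  | zero => simp
  | succ n ih =>
    rw [pow_succ, Module.End.mul_apply, ih]
    simp only [annihilation, LinearMap.coe_mk, AddHom.coe_mk]
    rw [← mul_assoc, ← Complex.ofReal_mul, ← Real.sqrt_mul (by positivity), ← add_assoc,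
      Nat.succ_descFactorial_succ]
    push_cast
    rw [mul_comm ((j : ℝ) + n + 1)]

theorem lossOp_apply {lam : ℝ} (h0 : 0 < lam) (h1 : lam < 1) (n : ℕ) (v : Hilb ℕ) (j : ℕ) :
    coeff (lossOp lam n v) j = (Real.sqrt ((j + n).descFactorial n) : ℂ) *
      ((Real.sqrt lam : ℂ) ^ (j + n) * coeff v (j + n)) := by
  have hT : ∀ (v : ℕ → ℂ) (j : ℕ), (annihilation ^ n * powNumber (Real.sqrt lam)) v j =
      (Real.sqrt ((j + n).descFactorial n) : ℂ) *
        ((Real.sqrt lam : ℂ) ^ (j + n) * v (j + n)) := by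
    intro v j
    rw [Module.End.mul_apply, annihilation_pow_apply]
    rfl
  rw [lossOp, boundedOp_apply, hT]
  have hq : 0 < 1 - lam := by linarith
  obtain ⟨K, hK⟩ := exists_weighted_shift
    (fun j => (Real.sqrt ((j + n).descFactorial n) : ℂ) * (Real.sqrt lam : ℂ) ^ (j + n))
    (Real.sqrt (n.factorial * lam ^ n / (1 - lam) ^ n)) (fun j => by
      rw [← Complex.ofReal_pow, ← Complex.ofReal_mul, Complex.norm_real, Real.norm_eq_abs,
        abs_of_nonneg (by positivity)]
      apply Real.le_sqrt_of_sq_le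
      rw [mul_pow, ← pow_mul, mul_comm (j + n) 2, pow_mul, Real.sq_sqrt h0.le,
        Real.sq_sqrt (by positivity), Nat.descFactorial_eq_factorial_mul_choose,
        le_div_iff₀ (by positivity)]
      have hb : lam ^ j * (1 - lam) ^ n * ((j + n).choose n : ℝ) ≤ 1 := by
        have hsum := add_pow lam (1 - lam) (j + n)
        rw [add_sub_cancel, one_pow] at hsum
        refine le_trans (le_of_eq ?_) (Finset.single_le_sum
          (f := fun i => lam ^ i * (1 - lam) ^ (j + n - i) * ((j + n).choose i : ℝ))
          (fun i _ => by positivity) (Finset.mem_range.mpr (by omega : j < j + n + 1))) |>.trans hsum.ge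
        have : (j + n).choose n = (j + n).choose j := by
          rw [← Nat.choose_symm_add]
        simp [this]
      calc ((n.factorial * (j + n).choose n : ℕ) : ℝ) * lam ^ (j + n) * (1 - lam) ^ n
          = n.factorial * lam ^ n * (lam ^ j * (1 - lam) ^ n * ((j + n).choose n : ℝ)) := by
            push_cast; ring
        _ ≤ n.factorial * lam ^ n * 1 := by gcongr
        _ = _ := by ring) n
  exact ⟨K, fun v j => by rw [hK, hT]; ring⟩

end

end Blurring

namespace Blurring

noncomputable section

/-! ### The canonical basis of `ℓ²(ι)` -/

/-! Density reduces the theorem to a count of permutations. The lifted blurring map and a concrete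
realisation of the limit map both have the form X ↦ ∑ⱼ Kⱼ X Kⱼ† with ∑ⱼ Kⱼ†Kⱼ ≤ 1, hence are linear
trace-norm contractions on trace class operators (`IsKraus.traceNorm_le`). With a uniform bound,
convergence need only be checked on the matrix units |s⟩⟨t|, whose span is dense
(`tendsto_traceNorm_of_ketBra`). Any other realisation of the tensor power is bounded too and agrees
with the concrete one on matrix units (`IsTensorPower.eq_on_ketBra`). Once n is at least the total
occupation of s and of t, the image of |s⟩⟨t| under either map has an entry at (h, k) only if h + j
= s and k + j = t for a common j. These entries are finitely many, so entrywise convergence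
suffices.

Write r = ⌊δn⌋ and |g| = ∑ gᵢ. The blurring map has Kraus operators (1 ⊗ ⟨z|) U_π (1 ⊗ |0…0⟩) /
√((n+r)!), one for each permutation π and each string z of length r. The entry at (h, k) is a
normalisation by sizes of type classes, times the number of z in which the nonzero symbols occur j
times, times a sum over pairs of strings x, y of types h, k (`inner_kraus_mixOp_eq`). Each pair
contributes the probability that a random permutation keeps the union of the supports of (x, z) and
(y, z) among n of the n + r positions. The supports of x and y are disjoint except for a fraction
O(1/n) of the pairs, and u given points are kept with probability tending to (1+δ)^(-u). The limit
entry is therefore √((h+j)!(k+j)!/(h!k!)) · δ^|j|/j! · (1+δ)^(-|h|-|k|-|j|), with multi-index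
factorials (`tendsto_inner_kraus_mixOp`).

On one mode, loss after damping has Kraus operators |h+j⟩ ↦ √(C(h+j,j) a^h b^j) |h⟩ with a = λμ² and
b = (1-λ)μ² (`pureLoss_damping_eq_kraus`). For the given parameters a = (1+δ)⁻² and b = δ/(1+δ), and
products of these amplitudes over the modes give exactly the limit entries (`prod_lossWeight_mul`).

The trace norm is handled through decompositions X = ∑ |uₐ⟩⟨vₐ|: it is the least value of ∑ ‖uₐ‖‖vₐ‖
(`HasAtoms.traceNorm_le`, `exists_hasAtoms`). -/

/-- The canonical Hilbert basis of `ℓ²(ι)`. -/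
def ketBasis (ι : Type) [DecidableEq ι] : HilbertBasis ι ℂ (Hilb ι) :=
  HilbertBasis.ofRepr (LinearIsometryEquiv.refl ℂ (lp (fun _ : ι => ℂ) 2))

theorem ketBasis_apply {ι : Type} [DecidableEq ι] (k : ι) : ketBasis ι k = ket k := by
  classical
  have h := (ketBasis ι).repr_symm_single k
  rw [← h, ket]
  refine (congrArg (fun v => (ketBasis ι).repr.symm v) ?_).trans rfl
  congr

theorem inner_ket_left {ι : Type} [DecidableEq ι] (k : ι) (v : Hilb ι) :
    ⟪ket k, v⟫_ℂ = coeff v k := by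
  refine (lp.inner_single_left (𝕜 := ℂ) k (1 : ℂ) v).trans ?_
  simp [coeff]

theorem inner_ket_right {ι : Type} [DecidableEq ι] (k : ι) (v : Hilb ι) :
    ⟪v, ket k⟫_ℂ = star (coeff v k) := by
  rw [← inner_ket_left, ← inner_conj_symm]; rfl

theorem inner_ket_ket {ι : Type} [DecidableEq ι] (h k : ι) :
    ⟪ket h, ket k⟫_ℂ = if h = k then (1 : ℂ) else 0 :=
  orthonormal_iff_ite.mp orthonormal_ket h k

theorem coeff_ket {ι : Type} [DecidableEq ι] (h k : ι) :
    coeff (ket k) h = if h = k then (1 : ℂ) else 0 := by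
  rw [← inner_ket_left, inner_ket_ket]

theorem norm_ket {ι : Type} [DecidableEq ι] (k : ι) : ‖(ket k : Hilb ι)‖ = 1 :=
  orthonormal_ket.1 k

theorem coeff_injective {ι : Type} : Function.Injective (coeff : Hilb ι → ι → ℂ) :=
  Subtype.val_injective

theorem hasSum_norm_coeff_sq {ι : Type} (v : Hilb ι) :
    HasSum (fun k => ‖coeff v k‖ ^ 2) (‖v‖ ^ 2) := by
  have hp : (0 : ℝ) < (2 : ℝ≥0∞).toReal := by simp
  have h := lp.hasSum_norm hp (v : lp (fun _ : ι => ℂ) 2)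
  have e : ((2 : ℝ≥0∞).toReal) = ((2 : ℕ) : ℝ) := by simp
  rw [e] at h
  simp only [Real.rpow_natCast] at h
  exact h

theorem Op.ext_ket {ι : Type} [DecidableEq ι] {X Y : Op ι}
    (h : ∀ i k : ι, ⟪ket i, X (ket k)⟫_ℂ = ⟪ket i, Y (ket k)⟫_ℂ) : X = Y := by
  have hd : (Submodule.span ℂ (Set.range (ket : ι → Hilb ι))).topologicalClosure = ⊤ := by
    have := (ketBasis ι).dense_span
    rwa [show (⇑(ketBasis ι) : ι → Hilb ι) = ket from funext ketBasis_apply] at this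
  refine ContinuousLinearMap.ext_on
    (Submodule.dense_iff_topologicalClosure_eq_top.mpr hd) ?_
  rintro _ ⟨k, rfl⟩
  apply coeff_injective
  funext i
  rw [← inner_ket_left, ← inner_ket_left, h]

/-! ### Polar decomposition -/

theorem inner_abs_abs {H : Type*} [NormedAddCommGroup H] [InnerProductSpace ℂ H] [CompleteSpace H]
    (X : H →L[ℂ] H) (v w : H) : ⟪CFC.abs X v, CFC.abs X w⟫_ℂ = ⟪X v, X w⟫_ℂ := by
  have hs : ContinuousLinearMap.adjoint (CFC.abs X) = CFC.abs X :=
    (CFC.abs_nonneg X).isSelfAdjoint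
  have hm : ⟪v, CFC.abs X (CFC.abs X w)⟫_ℂ = ⟪v, ContinuousLinearMap.adjoint X (X w)⟫_ℂ :=
    congrArg (fun T : H →L[ℂ] H => ⟪v, T w⟫_ℂ) (CFC.abs_mul_abs X)
  rw [← ContinuousLinearMap.adjoint_inner_right, hs, hm, ContinuousLinearMap.adjoint_inner_right]

theorem norm_abs_apply {H : Type*} [NormedAddCommGroup H] [InnerProductSpace ℂ H] [CompleteSpace H]
    (X : H →L[ℂ] H) (v : H) : ‖CFC.abs X v‖ = ‖X v‖ := by
  rw [@norm_eq_sqrt_re_inner ℂ, inner_abs_abs, ← @norm_eq_sqrt_re_inner ℂ]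

/-- Polar decomposition: `X = W |X|` and `|X| = W† X` for a contraction `W`. -/
theorem exists_polar {H : Type*} [NormedAddCommGroup H] [InnerProductSpace ℂ H] [CompleteSpace H]
    (X : H →L[ℂ] H) : ∃ W : H →L[ℂ] H, (∀ v, ‖W v‖ ≤ ‖v‖) ∧ (∀ v, W (CFC.abs X v) = X v) ∧
      ∀ v, ContinuousLinearMap.adjoint W (X v) = CFC.abs X v := by
  let K := (LinearMap.range (CFC.abs X).toLinearMap).topologicalClosure
  have hK : ∀ v, CFC.abs X v ∈ K := fun v =>
    Submodule.le_topologicalClosure _ (LinearMap.mem_range_self _ v)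
  let e : H →ₗ[ℂ] K := (CFC.abs X).toLinearMap.codRestrict K hK
  have hdense : DenseRange e := by
    intro y
    have hy : (y : H) ∈ closure (LinearMap.range (CFC.abs X).toLinearMap : Set H) := y.2
    rw [Metric.mem_closure_iff] at hy ⊢
    intro ε hε
    obtain ⟨_, ⟨v, rfl⟩, hb⟩ := hy ε hε
    exact ⟨e v, ⟨v, rfl⟩, hb⟩
  have hn : ∀ v, ‖X.toLinearMap v‖ ≤ 1 * ‖e v‖ := fun v => by
    rw [one_mul]; exact (norm_abs_apply X v).ge
  -- |X|v ↦ Xv is well defined and isometric because ‖|X|v‖ = ‖Xv‖. It extends to the closure K of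
  -- the range of |X|, and W is taken to be zero on the complement of K.
  let G : K →L[ℂ] H := X.toLinearMap.extendOfNorm e
  have : CompleteSpace K := (Submodule.isClosed_topologicalClosure _).completeSpace_coe
  let W : H →L[ℂ] H := G ∘L K.orthogonalProjectionOnto
  have hW : ∀ v, ‖W v‖ ≤ ‖v‖ := fun v => by
    refine (LinearMap.norm_extendOfNorm_apply_le hdense 1 hn _).trans ?_
    rw [one_mul]
    exact K.norm_orthogonalProjectionOnto_apply_le v
  have hWX : ∀ v, W (CFC.abs X v) = X v := fun v => by
    have h1 : K.orthogonalProjectionOnto (CFC.abs X v) = e v :=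
      Submodule.orthogonalProjectionOnto_mem_subspace_eq_self (⟨CFC.abs X v, hK v⟩ : K)
    change G (K.orthogonalProjectionOnto (CFC.abs X v)) = X v
    rw [h1]
    exact LinearMap.extendOfNorm_eq hdense ⟨1, hn⟩ v
  refine ⟨W, hW, hWX, fun v => ?_⟩
  have hWa : ‖ContinuousLinearMap.adjoint W (X v)‖ ≤ ‖X v‖ := by
    have h1 : ‖ContinuousLinearMap.adjoint W‖ ≤ 1 := by
      rw [LinearIsometryEquiv.norm_map]
      exact W.opNorm_le_bound zero_le_one fun v => by rw [one_mul]; exact hW v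
    simpa using (ContinuousLinearMap.le_opNorm _ (X v)).trans
      (mul_le_mul_of_nonneg_right h1 (norm_nonneg _))
  rw [← sub_eq_zero, ← norm_eq_zero]
  -- Equality case of Cauchy–Schwarz: ‖W†Xv‖ ≤ ‖Xv‖ = ‖|X|v‖, while ⟨W†Xv, |X|v⟩ = ⟨Xv, Xv⟩.
  have h2 : ‖ContinuousLinearMap.adjoint W (X v) - CFC.abs X v‖ ^ 2 ≤ 0 := by
    rw [@norm_sub_sq ℂ, ContinuousLinearMap.adjoint_inner_left, hWX, norm_abs_apply,
      inner_self_eq_norm_sq]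
    nlinarith [norm_nonneg (ContinuousLinearMap.adjoint W (X v))]
  nlinarith [norm_nonneg (ContinuousLinearMap.adjoint W (X v) - CFC.abs X v)]

/-! ### Decompositions into rank one operators -/

/-- `X = ∑ₐ |uₐ⟩⟨vₐ|` in the weak sense. -/
def HasAtoms {ι κ : Type} (X : Op ι) (u v : κ → Hilb ι) : Prop :=
  ∀ x y, HasSum (fun a => ⟪x, u a⟫_ℂ * ⟪v a, y⟫_ℂ) ⟪x, X y⟫_ℂ

theorem tsum_enorm_mul_le {J E F : Type*} [NormedAddCommGroup E] [NormedAddCommGroup F]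
    {f : J → E} {g : J → F} {A B : ℝ} (hA : 0 ≤ A) (hB : 0 ≤ B)
    (hf : ∀ s : Finset J, ∑ j ∈ s, ‖f j‖ ^ 2 ≤ A ^ 2)
    (hg : ∀ s : Finset J, ∑ j ∈ s, ‖g j‖ ^ 2 ≤ B ^ 2) :
    ∑' j, ‖f j‖ₑ * ‖g j‖ₑ ≤ ENNReal.ofReal A * ENNReal.ofReal B := by
  rw [← ENNReal.ofReal_mul hA]
  refine ENNReal.summable.tsum_le_of_sum_le fun s => ?_
  have h1 : ∑ j ∈ s, ‖f j‖ₑ * ‖g j‖ₑ = ENNReal.ofReal (∑ j ∈ s, ‖f j‖ * ‖g j‖) := by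
    rw [ENNReal.ofReal_sum_of_nonneg fun j _ => by positivity]
    refine Finset.sum_congr rfl fun j _ => ?_
    rw [ENNReal.ofReal_mul (norm_nonneg _), ofReal_norm, ofReal_norm]
  rw [h1]
  apply ENNReal.ofReal_le_ofReal
  refine abs_le_of_sq_le_sq' ?_ (by positivity) |>.2
  rw [mul_pow]
  exact (Finset.sum_mul_sq_le_sq_mul_sq s _ _).trans
    (mul_le_mul (hf s) (hg s) (Finset.sum_nonneg fun _ _ => by positivity) (by positivity))

theorem tsum_enorm_inner_ket_mul_le {ι : Type} [DecidableEq ι] (x y : Hilb ι) :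
    ∑' k : ι, ‖⟪ket k, x⟫_ℂ‖ₑ * ‖⟪y, ket k⟫_ℂ‖ₑ ≤ ‖x‖ₑ * ‖y‖ₑ := by
  rw [← ofReal_norm, ← ofReal_norm]
  refine tsum_enorm_mul_le (norm_nonneg _) (norm_nonneg _)
    (fun s => orthonormal_ket.sum_inner_products_le x) fun s => ?_
  rw [Finset.sum_congr rfl fun k _ => by rw [norm_inner_symm y (ket k)]]
  exact orthonormal_ket.sum_inner_products_le y

/-- Since |X| = W†X, the diagonal entry of |X| at k is ∑ₐ ⟨k, W†uₐ⟩⟨vₐ, k⟩. Exchange the sums over k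
and a; Cauchy–Schwarz and Bessel bound the sum over k by ‖W†uₐ‖‖vₐ‖. -/
theorem HasAtoms.traceNorm_le {ι κ : Type} [DecidableEq ι] {X : Op ι} {u v : κ → Hilb ι}
    (h : HasAtoms X u v) : traceNorm X ≤ ∑' a, ‖u a‖ₑ * ‖v a‖ₑ := by
  obtain ⟨W, hW, -, hWX⟩ := exists_polar X
  have hWa : ∀ x, ‖ContinuousLinearMap.adjoint W x‖ₑ ≤ ‖x‖ₑ := fun x => by
    have h1 : ‖ContinuousLinearMap.adjoint W‖ ≤ 1 := by
      rw [LinearIsometryEquiv.norm_map]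
      exact W.opNorm_le_bound zero_le_one fun v => by rw [one_mul]; exact hW v
    rw [← ofReal_norm, ← ofReal_norm]
    apply ENNReal.ofReal_le_ofReal
    simpa using (ContinuousLinearMap.le_opNorm _ x).trans
      (mul_le_mul_of_nonneg_right h1 (norm_nonneg _))
  have hk : ∀ k : ι, ENNReal.ofReal (⟪ket k, CFC.abs X (ket k)⟫_ℂ).re ≤
      ∑' a, ‖⟪ket k, ContinuousLinearMap.adjoint W (u a)⟫_ℂ‖ₑ * ‖⟪v a, ket k⟫_ℂ‖ₑ := by
    intro k
    have hs := h (W (ket k)) (ket k)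
    rw [← ContinuousLinearMap.adjoint_inner_right, hWX] at hs
    have h1 : ENNReal.ofReal (⟪ket k, CFC.abs X (ket k)⟫_ℂ).re ≤
        ‖⟪ket k, CFC.abs X (ket k)⟫_ℂ‖ₑ := by
      rw [← ofReal_norm]
      exact ENNReal.ofReal_le_ofReal (Complex.re_le_norm _)
    refine h1.trans ?_
    rw [← hs.tsum_eq]
    refine enorm_tsum_le_tsum_enorm.trans (le_of_eq (tsum_congr fun a => ?_))
    rw [enorm_mul, ContinuousLinearMap.adjoint_inner_right]
  calc traceNorm X ≤ ∑' k, ∑' a, ‖⟪ket k, ContinuousLinearMap.adjoint W (u a)⟫_ℂ‖ₑ *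
        ‖⟪v a, ket k⟫_ℂ‖ₑ := ENNReal.tsum_le_tsum hk
    _ = ∑' a, ∑' k, ‖⟪ket k, ContinuousLinearMap.adjoint W (u a)⟫_ℂ‖ₑ *
        ‖⟪v a, ket k⟫_ℂ‖ₑ := ENNReal.tsum_comm
    _ ≤ ∑' a, ‖u a‖ₑ * ‖v a‖ₑ := ENNReal.tsum_le_tsum fun a =>
        (tsum_enorm_inner_ket_mul_le _ _).trans (by gcongr; exact hWa _)

/-- With S = √|X|, inserting the basis into X = W S S gives X = ∑ₖ |W S k⟩⟨S k|, of cost at most ∑ₖ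
‖S k‖² = ∑ₖ ⟨k||X||k⟩. -/
theorem exists_hasAtoms {ι : Type} [DecidableEq ι] (X : Op ι) :
    ∃ u v : ι → Hilb ι, HasAtoms X u v ∧ ∑' k, ‖u k‖ₑ * ‖v k‖ₑ ≤ traceNorm X := by
  obtain ⟨W, hW, hWX, -⟩ := exists_polar X
  set S : Op ι := CFC.sqrt (CFC.abs X)
  have hSS : ∀ v, S (S v) = CFC.abs X v := fun v =>
    congrArg (fun T : Op ι => T v) (CFC.sqrt_mul_sqrt_self (CFC.abs X) (CFC.abs_nonneg X))
  have hSa : ∀ x y, ⟪S x, y⟫_ℂ = ⟪x, S y⟫_ℂ := fun x y => by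
    have : ContinuousLinearMap.adjoint S = S := (CFC.sqrt_nonneg (CFC.abs X)).isSelfAdjoint
    rw [← ContinuousLinearMap.adjoint_inner_left, this]
  refine ⟨fun k => W (S (ket k)), fun k => S (ket k), fun x y => ?_, ?_⟩
  · have h := (ketBasis ι).hasSum_inner_mul_inner (S (ContinuousLinearMap.adjoint W x)) (S y)
    simp only [ketBasis_apply, hSa, ContinuousLinearMap.adjoint_inner_left, hSS, hWX] at h ⊢
    exact h
  · refine ENNReal.tsum_le_tsum fun k => ?_
    have h1 : (⟪ket k, CFC.abs X (ket k)⟫_ℂ).re = ‖S (ket k)‖ * ‖S (ket k)‖ := by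
      rw [← hSS, ← hSa]
      exact inner_self_eq_norm_mul_norm (𝕜 := ℂ) _
    rw [h1, ENNReal.ofReal_mul (norm_nonneg _), ofReal_norm]
    gcongr
    rw [← ofReal_norm, ← ofReal_norm]
    exact ENNReal.ofReal_le_ofReal (hW _)

/-! ### The trace norm is a norm -/

/-- Concatenate optimal decompositions of X and Y; this avoids any comparison of |X + Y| with |X| +
|Y|. -/
theorem traceNorm_add_le {ι : Type} [DecidableEq ι] (X Y : Op ι) :
    traceNorm (X + Y) ≤ traceNorm X + traceNorm Y := by
  obtain ⟨u, v, h, hle⟩ := exists_hasAtoms X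
  obtain ⟨u', v', h', hle'⟩ := exists_hasAtoms Y
  have hs : HasAtoms (X + Y) (Sum.elim u u') (Sum.elim v v') := fun x y => by
    rw [add_apply, inner_add_right]
    exact HasSum.sum (f := fun a => ⟪x, Sum.elim u u' a⟫_ℂ * ⟪Sum.elim v v' a, y⟫_ℂ)
      (h x y) (h' x y)
  refine hs.traceNorm_le.trans ?_
  rw [ENNReal.summable.tsum_sum ENNReal.summable]
  exact add_le_add hle hle'

theorem traceNorm_smul_le {ι : Type} [DecidableEq ι] (c : ℂ) (X : Op ι) :
    traceNorm (c • X) ≤ ‖c‖ₑ * traceNorm X := by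
  obtain ⟨u, v, h, hle⟩ := exists_hasAtoms X
  have hs : HasAtoms (c • X) (fun a => c • u a) v := fun x y => by
    simpa [inner_smul_right, mul_assoc] using (h x y).mul_left c
  refine hs.traceNorm_le.trans ?_
  simp only [enorm_smul, mul_assoc, ENNReal.tsum_mul_left]
  gcongr

theorem traceNorm_zero {ι : Type} [DecidableEq ι] : traceNorm (0 : Op ι) = 0 := by
  simpa using traceNorm_smul_le (0 : ℂ) (0 : Op ι)

theorem traceNorm_neg_le {ι : Type} [DecidableEq ι] (X : Op ι) : traceNorm (-X) ≤ traceNorm X := by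
  simpa using traceNorm_smul_le (-1 : ℂ) X

theorem traceNorm_sub_le {ι : Type} [DecidableEq ι] (X Y : Op ι) :
    traceNorm (X - Y) ≤ traceNorm X + traceNorm Y := by
  rw [sub_eq_add_neg]
  exact (traceNorm_add_le _ _).trans (add_le_add le_rfl (traceNorm_neg_le Y))

theorem traceNorm_sum_le {ι κ : Type} [DecidableEq ι] (s : Finset κ) (X : κ → Op ι) :
    traceNorm (∑ a ∈ s, X a) ≤ ∑ a ∈ s, traceNorm (X a) := by
  classical
  induction s using Finset.induction_on with
  | empty => simp [traceNorm_zero]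
  | insert a s ha ih =>
    rw [Finset.sum_insert ha, Finset.sum_insert ha]
    exact (traceNorm_add_le _ _).trans (add_le_add le_rfl ih)

theorem IsTraceClass.add {ι : Type} [DecidableEq ι] {X Y : Op ι} (hX : IsTraceClass X)
    (hY : IsTraceClass Y) : IsTraceClass (X + Y) :=
  ne_top_of_le_ne_top (ENNReal.add_ne_top.mpr ⟨hX, hY⟩) (traceNorm_add_le X Y)

theorem IsTraceClass.sub {ι : Type} [DecidableEq ι] {X Y : Op ι} (hX : IsTraceClass X)
    (hY : IsTraceClass Y) : IsTraceClass (X - Y) :=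
  ne_top_of_le_ne_top (ENNReal.add_ne_top.mpr ⟨hX, hY⟩) (traceNorm_sub_le X Y)

/-- The rank one operator `|u⟩⟨v|`. -/
def ketBra {ι : Type} (u v : Hilb ι) : Op ι := InnerProductSpace.rankOne ℂ u v

theorem inner_ketBra {ι : Type} (u v x y : Hilb ι) :
    ⟪x, ketBra u v y⟫_ℂ = ⟪x, u⟫_ℂ * ⟪v, y⟫_ℂ := by
  simp [ketBra, mul_comm]

theorem hasAtoms_ketBra {ι : Type} (u v : Hilb ι) :
    HasAtoms (ketBra u v) (fun _ : Unit => u) (fun _ : Unit => v) := fun x y => by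
  rw [inner_ketBra]
  exact hasSum_unique _

theorem traceNorm_ketBra_le {ι : Type} [DecidableEq ι] (u v : Hilb ι) :
    traceNorm (ketBra u v) ≤ ‖u‖ₑ * ‖v‖ₑ := by
  simpa using (hasAtoms_ketBra u v).traceNorm_le

theorem isTraceClass_ketBra {ι : Type} [DecidableEq ι] (u v : Hilb ι) :
    IsTraceClass (ketBra u v) :=
  ne_top_of_le_ne_top (ENNReal.mul_ne_top enorm_ne_top enorm_ne_top) (traceNorm_ketBra_le u v)

/-- The same cost dominates the operator norm. This turns trace-norm estimates into absolute
convergence of series of operators. -/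
theorem HasAtoms.enorm_le {ι κ : Type} {X : Op ι} {u v : κ → Hilb ι}
    (h : HasAtoms X u v) : ‖X‖ₑ ≤ ∑' a, ‖u a‖ₑ * ‖v a‖ₑ := by
  by_cases hc : ∑' a, ‖u a‖ₑ * ‖v a‖ₑ = ∞
  · rw [hc]; exact le_top
  set c := ∑' a, ‖u a‖ₑ * ‖v a‖ₑ
  rw [← ofReal_norm, ← ENNReal.ofReal_toReal hc]
  apply ENNReal.ofReal_le_ofReal
  refine X.opNorm_le_bound ENNReal.toReal_nonneg fun y => ?_
  have key : ∀ x, ‖⟪x, X y⟫_ℂ‖ ≤ ‖x‖ * (c.toReal * ‖y‖) := by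
    intro x
    have h1 : ‖⟪x, X y⟫_ℂ‖ₑ ≤ ENNReal.ofReal (‖x‖ * (c.toReal * ‖y‖)) := by
      rw [← (h x y).tsum_eq, ENNReal.ofReal_mul (norm_nonneg _),
        ENNReal.ofReal_mul ENNReal.toReal_nonneg, ENNReal.ofReal_toReal hc, ofReal_norm,
        ofReal_norm, ← ENNReal.tsum_mul_right, ← ENNReal.tsum_mul_left]
      refine enorm_tsum_le_tsum_enorm.trans (ENNReal.tsum_le_tsum fun a => ?_)
      rw [enorm_mul]
      have hi : ∀ p q : Hilb ι, ‖⟪p, q⟫_ℂ‖ₑ ≤ ‖p‖ₑ * ‖q‖ₑ := fun p q => by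
        rw [← ofReal_norm, ← ofReal_norm, ← ofReal_norm, ← ENNReal.ofReal_mul (norm_nonneg _)]
        exact ENNReal.ofReal_le_ofReal (norm_inner_le_norm p q)
      calc _ ≤ (‖x‖ₑ * ‖u a‖ₑ) * (‖v a‖ₑ * ‖y‖ₑ) := mul_le_mul' (hi _ _) (hi _ _)
        _ = _ := by ring
    rw [← ofReal_norm] at h1
    exact (ENNReal.ofReal_le_ofReal_iff (by positivity)).mp h1
  have h2 := key (X y)
  rw [inner_self_eq_norm_sq_to_K] at h2
  simp only [norm_pow, RCLike.norm_ofReal, abs_norm] at h2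
  rcases (norm_nonneg (X y)).eq_or_lt with h0 | h0
  · rw [← h0]; positivity
  · nlinarith

/-! ### Maps in Kraus form -/

/-- The map `X ↦ ∑ⱼ Kⱼ X Kⱼ†`. -/
def kraus {ι J : Type} (K : J → Op ι) (X : Op ι) : Op ι :=
  ∑' j, K j ∘L X ∘L ContinuousLinearMap.adjoint (K j)

/-- `∑ⱼ Kⱼ† Kⱼ ≤ 1`. -/
def IsKraus {ι J : Type} (K : J → Op ι) : Prop :=
  ∀ (x : Hilb ι) (s : Finset J), ∑ j ∈ s, ‖K j x‖ ^ 2 ≤ ‖x‖ ^ 2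

theorem HasAtoms.conj {ι κ : Type} {X : Op ι} {u v : κ → Hilb ι} (h : HasAtoms X u v) (K : Op ι) :
    HasAtoms (K ∘L X ∘L ContinuousLinearMap.adjoint K) (fun a => K (u a)) (fun a => K (v a)) := by
  intro x y
  have := h (ContinuousLinearMap.adjoint K x) (ContinuousLinearMap.adjoint K y)
  simp only [ContinuousLinearMap.adjoint_inner_left, ContinuousLinearMap.adjoint_inner_right]
    at this
  exact this

theorem summable_norm_of_tsum_enorm {J E : Type*} [NormedAddCommGroup E] {f : J → E}
    (h : ∑' j, ‖f j‖ₑ ≠ ∞) : Summable fun j => ‖f j‖ := by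
  have := ENNReal.summable_toReal h
  simpa using this

theorem IsKraus.tsum_le {ι J : Type} {K : J → Op ι} (hK : IsKraus K) (u v : Hilb ι) :
    ∑' j, ‖K j u‖ₑ * ‖K j v‖ₑ ≤ ‖u‖ₑ * ‖v‖ₑ := by
  rw [← ofReal_norm, ← ofReal_norm]
  exact tsum_enorm_mul_le (norm_nonneg _) (norm_nonneg _) (hK u) (hK v)

theorem IsKraus.tsum_tsum_le {ι J κ : Type} {K : J → Op ι} (hK : IsKraus K) (u v : κ → Hilb ι) :
    ∑' j, ∑' a, ‖K j (u a)‖ₑ * ‖K j (v a)‖ₑ ≤ ∑' a, ‖u a‖ₑ * ‖v a‖ₑ := by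
  rw [ENNReal.tsum_comm]
  exact ENNReal.tsum_le_tsum fun a => hK.tsum_le _ _

/-- `kraus` is a `tsum` in operator norm, with a junk value when not summable. For trace class X,
absolute convergence follows by summing the costs of the conjugated decompositions. -/
theorem IsKraus.summable {ι J : Type} [DecidableEq ι] {K : J → Op ι} (hK : IsKraus K) {X : Op ι}
    (hX : IsTraceClass X) :
    Summable fun j => K j ∘L X ∘L ContinuousLinearMap.adjoint (K j) := by
  obtain ⟨u, v, h, hle⟩ := exists_hasAtoms X
  refine Summable.of_norm (summable_norm_of_tsum_enorm (ne_top_of_le_ne_top hX ?_))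
  exact (ENNReal.tsum_le_tsum fun j => (h.conj (K j)).enorm_le).trans
    ((hK.tsum_tsum_le u v).trans hle)

theorem IsKraus.hasSum_inner {ι J : Type} [DecidableEq ι] {K : J → Op ι} (hK : IsKraus K)
    {X : Op ι} (hX : IsTraceClass X) (x y : Hilb ι) :
    HasSum (fun j => ⟪ContinuousLinearMap.adjoint (K j) x,
      X (ContinuousLinearMap.adjoint (K j) y)⟫_ℂ) ⟪x, kraus K X y⟫_ℂ := by
  have h := ((innerSL ℂ x).hasSum
    ((ContinuousLinearMap.apply ℂ (Hilb ι) y).hasSum (hK.summable hX).hasSum))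
  simpa [kraus, ContinuousLinearMap.adjoint_inner_left] using h

theorem summable_inner_mul_inner {κ E : Type} [NormedAddCommGroup E] [InnerProductSpace ℂ E]
    {u v : κ → E} (h : ∑' a, ‖u a‖ₑ * ‖v a‖ₑ ≠ ∞) (x y : E) :
    Summable fun a => ⟪x, u a⟫_ℂ * ⟪v a, y⟫_ℂ := by
  have h1 : Summable fun a => ‖u a‖ * ‖v a‖ := by
    simpa using ENNReal.summable_toReal h
  refine Summable.of_norm_bounded (h1.mul_left (‖x‖ * ‖y‖)) fun a => ?_
  rw [norm_mul]
  calc _ ≤ (‖x‖ * ‖u a‖) * (‖v a‖ * ‖y‖) := mul_le_mul (norm_inner_le_norm _ _)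
        (norm_inner_le_norm _ _) (norm_nonneg _) (by positivity)
    _ = _ := by ring

/-- The vectors Kⱼuₐ and Kⱼvₐ decompose the image, and by Cauchy–Schwarz in j together with ∑ⱼ Kⱼ†Kⱼ
≤ 1 this costs no more than the decomposition of X. -/
theorem IsKraus.traceNorm_le {ι J : Type} [DecidableEq ι] {K : J → Op ι} (hK : IsKraus K)
    {X : Op ι} (hX : IsTraceClass X) : traceNorm (kraus K X) ≤ traceNorm X := by
  obtain ⟨u, v, h, hle⟩ := exists_hasAtoms X
  have hfin : ∑' p : J × ι, ‖K p.1 (u p.2)‖ₑ * ‖K p.1 (v p.2)‖ₑ ≤ traceNorm X := by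
    rw [ENNReal.tsum_prod (f := fun j a => ‖K j (u a)‖ₑ * ‖K j (v a)‖ₑ)]
    exact (hK.tsum_tsum_le u v).trans hle
  have hA : HasAtoms (kraus K X) (fun p : J × ι => K p.1 (u p.2)) (fun p => K p.1 (v p.2)) := by
    intro x y
    have hs := summable_inner_mul_inner (ne_top_of_le_ne_top hX hfin) x y
    have h1 := hs.hasSum.prod_fiberwise (fun j => (h.conj (K j)) x y)
    have h2 := (hK.hasSum_inner hX x y).unique (by
      simpa [ContinuousLinearMap.adjoint_inner_left] using h1)
    rw [h2]
    exact hs.hasSum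
  exact hA.traceNorm_le.trans hfin

theorem IsKraus.isTraceClass {ι J : Type} [DecidableEq ι] {K : J → Op ι} (hK : IsKraus K)
    {X : Op ι} (hX : IsTraceClass X) : IsTraceClass (kraus K X) :=
  ne_top_of_le_ne_top hX (hK.traceNorm_le hX)

theorem IsKraus.map_add {ι J : Type} [DecidableEq ι] {K : J → Op ι} (hK : IsKraus K)
    {X Y : Op ι} (hX : IsTraceClass X) (hY : IsTraceClass Y) :
    kraus K (X + Y) = kraus K X + kraus K Y := by
  rw [kraus, kraus, kraus, ← (hK.summable hX).tsum_add (hK.summable hY)]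
  simp

theorem IsKraus.map_smul {ι J : Type} [DecidableEq ι] {K : J → Op ι} (hK : IsKraus K) (c : ℂ)
    {X : Op ι} (hX : IsTraceClass X) : kraus K (c • X) = c • kraus K X := by
  rw [kraus, kraus, ← (hK.summable hX).tsum_const_smul]
  simp

/-! ### Weighted shifts -/

theorem exists_weighted_reindex {ι : Type} (w : ι → ℝ) (hw : ∀ h, |w h| ≤ 1) (g : ι → ι)
    (hg : Function.Injective g) :
    ∃ K : Op ι, ∀ (v : Hilb ι) (h : ι), coeff (K v) h = w h * coeff v (g h) := by
  have hle : ∀ (v : Hilb ι) (h : ι), ‖w h * coeff v (g h)‖ ^ 2 ≤ ‖coeff v (g h)‖ ^ 2 := by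
    intro v h
    rw [norm_mul, Complex.norm_real, Real.norm_eq_abs]
    gcongr
    exact mul_le_of_le_one_left (norm_nonneg _) (hw h)
  have hs : ∀ v : Hilb ι, Summable fun h => ‖coeff v (g h)‖ ^ 2 := fun v =>
    (hasSum_norm_coeff_sq v).summable.comp_injective hg
  have hs' : ∀ v : Hilb ι, Summable fun h => ‖w h * coeff v (g h)‖ ^ 2 := fun v =>
    (hs v).of_nonneg_of_le (fun _ => by positivity) (hle v)
  have hmem : ∀ v : Hilb ι, Memℓp (fun h => (w h : ℂ) * coeff v (g h)) 2 := fun v =>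
    memℓp_gen (by simpa using hs' v)
  let L : Hilb ι →ₗ[ℂ] Hilb ι :=
    { toFun := fun v => ⟨fun h => w h * coeff v (g h), hmem v⟩
      map_add' := fun u v => Subtype.ext (funext fun j => mul_add _ _ _)
      map_smul' := fun c v => Subtype.ext (funext fun j => mul_left_comm _ _ _) }
  refine ⟨L.mkContinuous 1 fun v => ?_, fun v j => rfl⟩
  rw [one_mul]
  refine abs_le_of_sq_le_sq' ?_ (norm_nonneg _) |>.2
  rw [← (hasSum_norm_coeff_sq v).tsum_eq, ← (hasSum_norm_coeff_sq (L v)).tsum_eq]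
  calc _ ≤ ∑' h, ‖coeff v (g h)‖ ^ 2 := (hs' v).tsum_le_tsum (hle v) (hs v)
    _ ≤ _ := tsum_comp_le_tsum_of_inj (hasSum_norm_coeff_sq v).summable (fun _ => by positivity) hg

/-- The weights `w j h` satisfy `∑_{h + j = s} (w j h)² ≤ 1`. -/
def IsLossWeight {ι : Type} [Add ι] (w : ι → ι → ℝ) : Prop :=
  ∀ (s : ι) (T : Finset (ι × ι)), (∀ p ∈ T, p.2 + p.1 = s) → ∑ p ∈ T, w p.1 p.2 ^ 2 ≤ 1

theorem IsLossWeight.abs_le {ι : Type} [Add ι] {w : ι → ι → ℝ} (hw : IsLossWeight w) (j h : ι) :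
    |w j h| ≤ 1 := by
  have := hw (h + j) {(j, h)} (by simp)
  rw [Finset.sum_singleton] at this
  exact (sq_le_one_iff_abs_le_one _).mp this

open Classical in
/-- The operator `|h + j⟩ ↦ w j h |h⟩` (and `0` if there is no such operator). -/
def shiftOp {ι : Type} [Add ι] (w : ι → ι → ℝ) (j : ι) : Op ι :=
  if h : ∃ K : Op ι, ∀ (v : Hilb ι) (h : ι), coeff (K v) h = w j h * coeff v (h + j) then h.choose
  else 0

theorem coeff_shiftOp {ι : Type} [Add ι] [IsRightCancelAdd ι] {w : ι → ι → ℝ}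
    (hw : IsLossWeight w) (j : ι) (v : Hilb ι) (h : ι) :
    coeff (shiftOp w j v) h = w j h * coeff v (h + j) := by
  have hex := exists_weighted_reindex (w j) (hw.abs_le j) (· + j) (add_left_injective j)
  rw [shiftOp, dif_pos hex]
  exact hex.choose_spec v h

theorem adjoint_shiftOp_ket {ι : Type} [DecidableEq ι] [Add ι] [IsRightCancelAdd ι]
    {w : ι → ι → ℝ} (hw : IsLossWeight w) (j h : ι) :
    ContinuousLinearMap.adjoint (shiftOp w j) (ket h) = (w j h : ℂ) • ket (h + j) := by
  refine ext_inner_right ℂ fun v => ?_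
  rw [ContinuousLinearMap.adjoint_inner_left, inner_ket_left, coeff_shiftOp hw, inner_smul_left,
    inner_ket_left, Complex.conj_ofReal]

/-- ∑ⱼ ‖Kⱼx‖² is a sum of w(j,h)²|x_{h+j}|² over pairs (j, h). Grouped by s = h + j, the weight of
each |xₛ|² is at most 1. -/
theorem IsLossWeight.isKraus {ι : Type} [DecidableEq ι] [Add ι] [IsRightCancelAdd ι]
    {w : ι → ι → ℝ} (hw : IsLossWeight w) : IsKraus (shiftOp w) := by
  intro x S
  have h1 := hasSum_sum fun (j : ι) (_ : j ∈ S) => hasSum_norm_coeff_sq (shiftOp w j x)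
  refine hasSum_le_of_sum_le h1 fun H => ?_
  simp only [coeff_shiftOp hw, norm_mul, mul_pow, Complex.norm_real, Real.norm_eq_abs, sq_abs]
  rw [Finset.sum_comm, ← Finset.sum_product']
  rw [← Finset.sum_fiberwise_of_maps_to (s := S ×ˢ H)
    (t := (S ×ˢ H).image fun p => p.2 + p.1) (g := fun p => p.2 + p.1)
    (fun p hp => Finset.mem_image_of_mem _ hp)]
  refine le_trans (Finset.sum_le_sum fun s _ => ?_)
    (sum_le_hasSum ((S ×ˢ H).image fun p => p.2 + p.1) (fun _ _ => by positivity)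
      (hasSum_norm_coeff_sq x))
  have h2 : ∑ p ∈ S ×ˢ H with p.2 + p.1 = s, w p.1 p.2 ^ 2 * ‖coeff x (p.2 + p.1)‖ ^ 2 =
      (∑ p ∈ S ×ˢ H with p.2 + p.1 = s, w p.1 p.2 ^ 2) * ‖coeff x s‖ ^ 2 := by
    rw [Finset.sum_mul]
    exact Finset.sum_congr rfl fun p hp => by rw [(Finset.mem_filter.mp hp).2]
  rw [h2]
  exact mul_le_of_le_one_left (by positivity) (hw s _ fun p hp => (Finset.mem_filter.mp hp).2)

theorem IsLossWeight.hasSum_inner {ι : Type} [DecidableEq ι] [Add ι] [IsRightCancelAdd ι]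
    {w : ι → ι → ℝ} (hw : IsLossWeight w) {X : Op ι} (hX : IsTraceClass X) (h k : ι) :
    HasSum (fun j => ((w j h * w j k : ℝ) : ℂ) * ⟪ket (h + j), X (ket (k + j))⟫_ℂ)
      ⟪ket h, kraus (shiftOp w) X (ket k)⟫_ℂ := by
  have := hw.isKraus.hasSum_inner hX (ket h) (ket k)
  simpa [adjoint_shiftOp_ket hw, inner_smul_left, inner_smul_right, mul_assoc, mul_left_comm]
    using this

/-! ### The loss channel after damping, on one mode and on several modes -/

/-- The amplitude `√(C(h+j, j) a^h b^j)`. -/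
def lossWeight (a b : ℝ) (j h : ℕ) : ℝ := Real.sqrt ((h + j).choose j * a ^ h * b ^ j)

theorem lossWeight_sq {a b : ℝ} (ha : 0 ≤ a) (hb : 0 ≤ b) (j h : ℕ) :
    lossWeight a b j h ^ 2 = (h + j).choose j * a ^ h * b ^ j :=
  Real.sq_sqrt (by positivity)

/-- By the binomial theorem the sum equals (b + a)^s. -/
theorem sum_lossWeight_sq_le {a b : ℝ} (ha : 0 ≤ a) (hb : 0 ≤ b) (hab : a + b ≤ 1) (s : ℕ) :
    ∑ j ∈ Finset.range (s + 1), lossWeight a b j (s - j) ^ 2 ≤ 1 := by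
  refine le_trans (le_of_eq ?_) (pow_le_one₀ (add_nonneg hb ha) (by linarith) : (b + a) ^ s ≤ 1)
  rw [add_pow]
  refine Finset.sum_congr rfl fun j hj => ?_
  have hj' : s - j + j = s := Nat.sub_add_cancel (Nat.lt_succ_iff.mp (Finset.mem_range.mp hj))
  rw [lossWeight_sq ha hb, hj']
  ring

/-- For fixed s, a pair (j, h) with h + j = s is determined by j, which lies in the box j ≤ s. The
sum over the box factorises into one binomial sum for each mode. -/
theorem isLossWeight_pi {a b : ℝ} (ha : 0 ≤ a) (hb : 0 ≤ b) (hab : a + b ≤ 1) (m : ℕ) :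
    IsLossWeight fun j h : Fin m → ℕ => ∏ i, lossWeight a b (j i) (h i) := by
  intro s T hT
  have hinj : Set.InjOn Prod.fst (T : Set ((Fin m → ℕ) × (Fin m → ℕ))) := by
    intro p hp q hq hpq
    have h1 := hT p hp
    rw [← hT q hq, hpq] at h1
    exact Prod.ext hpq (add_left_injective q.1 h1)
  have h2 : ∀ p ∈ T, ∀ i, p.2 i = s i - p.1 i := fun p hp i => by
    have := congrFun (hT p hp) i
    simp only [Pi.add_apply] at this
    omega
  calc ∑ p ∈ T, (∏ i, lossWeight a b (p.1 i) (p.2 i)) ^ 2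
      = ∑ p ∈ T, ∏ i, lossWeight a b (p.1 i) (s i - p.1 i) ^ 2 := by
        refine Finset.sum_congr rfl fun p hp => ?_
        rw [← Finset.prod_pow]
        exact Finset.prod_congr rfl fun i _ => by rw [h2 p hp i]
    _ = ∑ j ∈ T.image Prod.fst, ∏ i, lossWeight a b (j i) (s i - j i) ^ 2 :=
        (Finset.sum_image (f := fun j : Fin m → ℕ => ∏ i, lossWeight a b (j i) (s i - j i) ^ 2)
          hinj).symm
    _ ≤ ∑ j ∈ Fintype.piFinset fun i => Finset.range (s i + 1),
          ∏ i, lossWeight a b (j i) (s i - j i) ^ 2 := by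
        refine Finset.sum_le_sum_of_subset_of_nonneg ?_ fun _ _ _ =>
          Finset.prod_nonneg fun _ _ => by positivity
        intro j hj
        obtain ⟨p, hp, rfl⟩ := Finset.mem_image.mp hj
        rw [Fintype.mem_piFinset]
        intro i
        have := congrFun (hT p hp) i
        simp only [Pi.add_apply] at this
        rw [Finset.mem_range]
        omega
    _ = ∏ i, ∑ j ∈ Finset.range (s i + 1), lossWeight a b j (s i - j) ^ 2 :=
        (Finset.prod_univ_sum (fun i => Finset.range (s i + 1))
          fun i j => lossWeight a b j (s i - j) ^ 2).symm
    _ ≤ 1 := Finset.prod_le_one (fun _ _ => Finset.sum_nonneg fun _ _ => by positivity)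
        fun i _ => sum_lossWeight_sq_le ha hb hab (s i)

theorem isLossWeight_nat {a b : ℝ} (ha : 0 ≤ a) (hb : 0 ≤ b) (hab : a + b ≤ 1) :
    IsLossWeight (lossWeight a b) := by
  intro s T hT
  have := isLossWeight_pi ha hb hab 1 (fun _ => s)
    (T.map ⟨fun p => (fun _ => p.1, fun _ => p.2), fun p q h => by
      simp only [Prod.mk.injEq] at h
      exact Prod.ext (congrFun h.1 0) (congrFun h.2 0)⟩) (by
        intro p hp
        obtain ⟨q, hq, rfl⟩ := Finset.mem_map.mp hp
        exact funext fun _ => hT q hq)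
  rw [Finset.sum_map] at this
  simp only [Finset.univ_unique, Finset.prod_singleton] at this
  exact this

theorem adjoint_boundedOp_powNumber {mu : ℝ} (h0 : 0 ≤ mu) (h1 : mu ≤ 1) :
    ContinuousLinearMap.adjoint (boundedOp (powNumber mu)) = boundedOp (powNumber mu) := by
  refine Op.ext_ket fun h k => ?_
  rw [ContinuousLinearMap.adjoint_inner_right, inner_ket_right, inner_ket_left,
    boundedOp_powNumber_apply h0 h1, boundedOp_powNumber_apply h0 h1, coeff_ket, coeff_ket]
  by_cases h : h = k
  · subst h; simp
  · simp [h, Ne.symm h]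

/-- The left side is the coefficient of |h⟩ in √(q^n/n!) a^n λ^{a†a/2} μ^{a†a} |h+n⟩ with q = 1/λ -
1. Compare squares and use qλ = 1 - λ. -/
theorem lossWeight_eq {lam mu : ℝ} (h0 : 0 < lam) (h1 : lam < 1) (hm0 : 0 ≤ mu) (n h : ℕ) :
    Real.sqrt (1 / (n.factorial : ℝ) * (1 / lam - 1) ^ n) *
      (Real.sqrt ((h + n).descFactorial n) * (Real.sqrt lam ^ (h + n) * mu ^ (h + n))) =
    lossWeight (lam * mu ^ 2) ((1 - lam) * mu ^ 2) n h := by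
  have hl : 0 ≤ 1 / lam - 1 := by rw [sub_nonneg, le_div_iff₀ h0]; linarith
  have hq : 0 ≤ 1 - lam := by linarith
  symm
  rw [lossWeight, Real.sqrt_eq_iff_mul_self_eq (by positivity) (by positivity), ← sq]
  rw [mul_pow (Real.sqrt _), mul_pow (Real.sqrt _), mul_pow (Real.sqrt lam ^ _),
    Real.sq_sqrt (by positivity), Real.sq_sqrt (by positivity),
    ← pow_mul (Real.sqrt lam), mul_comm (h + n) 2, pow_mul, Real.sq_sqrt h0.le,
    Nat.descFactorial_eq_factorial_mul_choose]
  have hf : (n.factorial : ℝ) ≠ 0 := by positivity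
  have e : 1 - lam = (1 / lam - 1) * lam := by field_simp
  rw [e]
  generalize 1 / lam - 1 = q
  push_cast
  field_simp
  ring

/-- The series agree term by term, so X need not be trace class: the scalar of each term is split
into equal square roots, absorbed by the operators on the two sides of X. -/
theorem pureLoss_damping_eq_kraus {lam mu : ℝ} (h0 : 0 < lam) (h1 : lam < 1) (hm0 : 0 ≤ mu)
    (hm1 : mu ≤ 1) (X : Op ℕ) :
    pureLoss lam (damping mu X) =
      kraus (shiftOp (lossWeight (lam * mu ^ 2) ((1 - lam) * mu ^ 2))) X := by
  have hl : 0 ≤ 1 / lam - 1 := by rw [sub_nonneg, le_div_iff₀ h0]; linarith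
  have hw : IsLossWeight (lossWeight (lam * mu ^ 2) ((1 - lam) * mu ^ 2)) :=
    isLossWeight_nat (by positivity) (mul_nonneg (by linarith) (by positivity))
      (by nlinarith)
  rw [pureLoss, kraus]
  refine tsum_congr fun n => ?_
  set c : ℝ := 1 / (n.factorial : ℝ) * (1 / lam - 1) ^ n with hc
  have hc0 : 0 ≤ c := by positivity
  have hK : shiftOp (lossWeight (lam * mu ^ 2) ((1 - lam) * mu ^ 2)) n =
      (Real.sqrt c : ℂ) • (lossOp lam n ∘L boundedOp (powNumber mu)) := by
    ext1 v
    apply coeff_injective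
    funext h
    rw [coeff_shiftOp hw, ← lossWeight_eq h0 h1 hm0]
    change _ = (Real.sqrt c : ℂ) * coeff (lossOp lam n (boundedOp (powNumber mu) v)) h
    rw [lossOp_apply h0 h1, boundedOp_powNumber_apply hm0 hm1]
    push_cast
    ring
  have hcc : ((c : ℝ) : ℂ) = (Real.sqrt c : ℂ) * (Real.sqrt c : ℂ) := by
    rw [← Complex.ofReal_mul, Real.mul_self_sqrt hc0]
  rw [hK, hcc, mul_smul]
  simp only [map_smulₛₗ, ContinuousLinearMap.adjoint_comp, adjoint_boundedOp_powNumber hm0 hm1,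
    Complex.conj_ofReal, damping, ContinuousLinearMap.smul_comp, ContinuousLinearMap.comp_smul,
    ContinuousLinearMap.comp_assoc]

/-! ### Products of series over several indices -/

theorem summable_and_tsum_prod {R κ : Type*} [NormedCommRing R] [NormOneClass R]
    [CompleteSpace R] {m : ℕ} (f : Fin m → κ → R) (hf : ∀ i, Summable fun a => ‖f i a‖) :
    (Summable fun j : Fin m → κ => ‖∏ i, f i (j i)‖) ∧
      ∑' j : Fin m → κ, ∏ i, f i (j i) = ∏ i, ∑' a, f i a := by
  induction m with
  | zero =>
    refine ⟨(hasSum_unique _).summable, ?_⟩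
    rw [tsum_eq_single default fun j hj => (hj (Subsingleton.elim _ _)).elim]
    simp
  | succ m ih =>
    obtain ⟨ih1, ih2⟩ := ih (fun i => f i.succ) fun i => hf i.succ
    have e := fun (p : κ × (Fin m → κ)) => show ∏ i, f i (Fin.consEquiv (fun _ => κ) p i) =
        f 0 p.1 * ∏ i, f i.succ (p.2 i) by
      rw [Fin.prod_univ_succ]; simp [Fin.consEquiv]
    constructor
    · rw [← (Fin.consEquiv fun _ : Fin (m + 1) => κ).summable_iff]
      refine (Summable.mul_norm (hf 0) ih1).congr fun p => ?_
      simp only [Function.comp_apply]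
      rw [e]
    · rw [← (Fin.consEquiv fun _ : Fin (m + 1) => κ).tsum_eq, tsum_congr e,
        ← tsum_mul_tsum_of_summable_norm (hf 0) ih1, ih2, Fin.prod_univ_succ]

theorem hasSum_prod_pi {R κ : Type*} [NormedCommRing R] [NormOneClass R] [CompleteSpace R] {m : ℕ}
    (f : Fin m → κ → R) (hf : ∀ i, Summable fun a => ‖f i a‖) :
    HasSum (fun j : Fin m → κ => ∏ i, f i (j i)) (∏ i, ∑' a, f i a) := by
  obtain ⟨h1, h2⟩ := summable_and_tsum_prod f hf
  rw [← h2]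
  exact h1.of_norm.hasSum

/-! ### Tensor products of trace class operators -/

theorem exists_tensorVec {m : ℕ} (u : Fin m → Hilb ℕ) :
    ∃ t : Fock m, (∀ h, coeff t h = ∏ i, coeff (u i) (h i)) ∧ ‖t‖ = ∏ i, ‖u i‖ := by
  have hs := hasSum_prod_pi (fun i k => ‖coeff (u i) k‖ ^ 2) fun i => by
    simpa using (hasSum_norm_coeff_sq (u i)).summable
  simp only [fun i => (hasSum_norm_coeff_sq (u i)).tsum_eq, Finset.prod_pow, ← norm_prod] at hs
  let t : Fock m := ⟨fun h => ∏ i, coeff (u i) (h i), memℓp_gen (by simpa using hs.summable)⟩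
  refine ⟨t, fun h => rfl, ?_⟩
  have := (hasSum_norm_coeff_sq t).unique hs
  exact (sq_eq_sq₀ (norm_nonneg _) (Finset.prod_nonneg fun _ _ => norm_nonneg _)).mp this

/-- Finite cost makes ∑ |uₐ⟩⟨vₐ| converge in norm to an operator, which must equal Y because their
entries agree. -/
theorem hasAtoms_of_ket {ι κ : Type} [DecidableEq ι] {Y : Op ι} {u v : κ → Hilb ι}
    (hfin : ∑' a, ‖u a‖ₑ * ‖v a‖ₑ ≠ ∞)
    (h : ∀ i k : ι, HasSum (fun a => ⟪ket i, u a⟫_ℂ * ⟪v a, ket k⟫_ℂ) ⟪ket i, Y (ket k)⟫_ℂ) :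
    HasAtoms Y u v := by
  have hs : Summable fun a => ketBra (u a) (v a) := by
    refine Summable.of_norm (summable_norm_of_tsum_enorm (ne_top_of_le_ne_top hfin ?_))
    refine ENNReal.tsum_le_tsum fun a => ?_
    simpa using (hasAtoms_ketBra (u a) (v a)).enorm_le
  have hA : HasAtoms (∑' a, ketBra (u a) (v a)) u v := fun x y => by
    have h := ((innerSL ℂ x).hasSum
      ((ContinuousLinearMap.apply ℂ (Hilb ι) y).hasSum hs.hasSum))
    simpa [inner_ketBra] using h
  have : Y = ∑' a, ketBra (u a) (v a) := Op.ext_ket fun i k => (h i k).unique (hA _ _)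
  rwa [this]

/-- `IsTensorProduct` speaks of matrix elements only. Tensor products of the vectors decomposing the
factors decompose Y, and their total cost is the product of the costs. -/
theorem IsTensorProduct.isTraceClass {m : ℕ} {X : Fin m → Op ℕ} {Y : Op (Fin m → ℕ)}
    (hX : ∀ i, IsTraceClass (X i)) (h : IsTensorProduct X Y) : IsTraceClass Y := by
  choose u v hA hle using fun i => exists_hasAtoms (X i)
  choose tu htu hntu using fun a : Fin m → ℕ => exists_tensorVec fun i => u i (a i)
  choose tv htv hntv using fun a : Fin m → ℕ => exists_tensorVec fun i => v i (a i)
  have hs : ∀ i, Summable fun a => ‖‖u i a‖ * ‖v i a‖‖ := fun i => by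
    simpa using ENNReal.summable_toReal (ne_top_of_le_ne_top (hX i) (hle i))
  have hfin : ∑' a, ‖tu a‖ₑ * ‖tv a‖ₑ ≠ ∞ := by
    have h1 := (hasSum_prod_pi _ hs).summable
    have h2 : ∀ a, ‖tu a‖ₑ * ‖tv a‖ₑ =
        ENNReal.ofReal (∏ i, ‖u i (a i)‖ * ‖v i (a i)‖) := fun a => by
      rw [Finset.prod_mul_distrib, ← hntu, ← hntv, ENNReal.ofReal_mul (norm_nonneg _),
        ofReal_norm, ofReal_norm]
    rw [tsum_congr h2]
    exact h1.tsum_ofReal_ne_top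
  have hY : HasAtoms Y tu tv := hasAtoms_of_ket hfin fun p q => by
    rw [h p q]
    have h3 := hasSum_prod_pi
      (fun i a => ⟪ket (p i), u i a⟫_ℂ * ⟪v i a, ket (q i)⟫_ℂ)
      fun i => (hA i (ket (p i)) (ket (q i))).summable.norm
    simp only [fun i => (hA i (ket (p i)) (ket (q i))).tsum_eq] at h3
    refine h3.congr_fun fun a => ?_
    simp only [inner_ket_left, inner_ket_right, htu, htv, star_prod, Finset.prod_mul_distrib]
  exact ne_top_of_le_ne_top hfin hY.traceNorm_le

/-- On a tensor product, the series over j ∈ ℕ^m for an entry has product terms, hence is the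
product of the one-mode series. -/
theorem isTensorPower_kraus {a b : ℝ} (ha : 0 ≤ a) (hb : 0 ≤ b) (hab : a + b ≤ 1) (m : ℕ) :
    IsTensorPower m (kraus (shiftOp (lossWeight a b)))
      (kraus (shiftOp fun j h : Fin m → ℕ => ∏ i, lossWeight a b (j i) (h i))) where
  map_add _ _ hX hY := (isLossWeight_pi ha hb hab m).isKraus.map_add hX hY
  map_smul c _ hX := (isLossWeight_pi ha hb hab m).isKraus.map_smul c hX
  bounded := ⟨1, fun X hX => by simpa using (isLossWeight_pi ha hb hab m).isKraus.traceNorm_le hX⟩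
  map_tensor X Y hX h p q := by
    have h1 := (isLossWeight_pi ha hb hab m).hasSum_inner (h.isTraceClass hX) p q
    have h2 := fun i => (isLossWeight_nat ha hb hab).hasSum_inner (hX i) (p i) (q i)
    have h3 := hasSum_prod_pi _ fun i => (h2 i).summable.norm
    simp only [fun i => (h2 i).tsum_eq] at h3
    refine h1.unique ?_
    refine h3.congr_fun fun j => ?_
    rw [h, Finset.prod_mul_distrib]
    simp only [Pi.add_apply, Complex.ofReal_mul, Complex.ofReal_prod, Finset.prod_mul_distrib]

/-! ### Kraus form of the blurring map -/

/-- The last `r` entries of the string `(x, z) ∘ π` vanish. -/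
def ZeroTail {m n r : ℕ} (π : Equiv.Perm (Fin (n + r))) (x : Fin n → Fin (m + 1))
    (z : Fin r → Fin (m + 1)) : Prop :=
  ∀ i : Fin r, Fin.append x z (π (Fin.natAdd n i)) = 0

instance {m n r : ℕ} (π : Equiv.Perm (Fin (n + r))) (x : Fin n → Fin (m + 1))
    (z : Fin r → Fin (m + 1)) : Decidable (ZeroTail π x z) :=
  inferInstanceAs (Decidable (∀ i : Fin r, Fin.append x z (π (Fin.natAdd n i)) = 0))

/-- The first `n` entries of the string `(x, z) ∘ π`. -/
def mixHead {m n r : ℕ} (π : Equiv.Perm (Fin (n + r))) (x : Fin n → Fin (m + 1))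
    (z : Fin r → Fin (m + 1)) : Fin n → Fin (m + 1) :=
  fun i => Fin.append x z (π (Fin.castAdd r i))

/-- The matrix `(1 ⊗ ⟨z|) U_π (1 ⊗ |0 … 0⟩)`. -/
def mixMat {m n r : ℕ} (π : Equiv.Perm (Fin (n + r))) (z : Fin r → Fin (m + 1)) :
    TensorMat (m + 1) n :=
  Matrix.of fun x p => if ZeroTail π x z ∧ mixHead π x z = p then 1 else 0

theorem sum_mixMat_mul {m n r : ℕ} (π : Equiv.Perm (Fin (n + r))) (z : Fin r → Fin (m + 1))
    (x : Fin n → Fin (m + 1)) (f : (Fin n → Fin (m + 1)) → ℂ) :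
    ∑ p, mixMat π z x p * f p = if ZeroTail π x z then f (mixHead π x z) else 0 := by
  by_cases h : ZeroTail π x z <;> simp [mixMat, h]

theorem permUnitary_mul_mul {d N : ℕ} (π : Equiv.Perm (Fin N)) (T : TensorMat d N)
    (x y : Fin N → Fin d) :
    (permUnitary d π * T * (permUnitary d π).conjTranspose) x y = T (x ∘ π) (y ∘ π) := by
  have h : ∀ x y : Fin N → Fin d, (x = y ∘ ⇑π⁻¹) ↔ (x ∘ π = y) := by
    intro x y
    constructor
    · rintro rfl; ext i; simp
    · rintro rfl; ext i; simp
  have h' : ∀ x y, permUnitary d π x y = if x ∘ π = y then 1 else 0 := fun x y => by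
    simp only [permUnitary, Matrix.of_apply, h]
  simp [Matrix.mul_apply, h']

theorem prod_single_zero {m r : ℕ} (p q : Fin r → Fin (m + 1)) :
    ∏ i, (Matrix.single 0 0 1 : Matrix (Fin (m + 1)) (Fin (m + 1)) ℂ) (p i) (q i) =
      if (∀ i, p i = 0) ∧ ∀ i, q i = 0 then 1 else 0 := by
  split_ifs with h
  · simp [h.1, h.2]
  · rw [not_and_or, not_forall, not_forall] at h
    rcases h with ⟨i, hi⟩ | ⟨i, hi⟩
    · exact Finset.prod_eq_zero (Finset.mem_univ i) (by simp [Matrix.single, Ne.symm hi])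
    · exact Finset.prod_eq_zero (Finset.mem_univ i) (by simp [Matrix.single, Ne.symm hi])

/-- The partial trace supplies the sum over z and the symmetrisation the sum over π; the factor
|0⟩⟨0|^{⊗r} forces a vanishing tail in both the row and the column string. -/
theorem blurringFull_eq_sum {m : ℕ} (n : ℕ) (δ : ℝ) (A : TensorMat (m + 1) n) :
    blurringFull (Matrix.single 0 0 1) n δ A =
      ∑ p : Equiv.Perm (Fin (n + ⌊δ * n⌋₊)) × (Fin ⌊δ * n⌋₊ → Fin (m + 1)),
        ((n + ⌊δ * n⌋₊).factorial : ℂ)⁻¹ •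
          (mixMat p.1 p.2 * A * (mixMat p.1 p.2).conjTranspose) := by
  generalize hr : ⌊δ * n⌋₊ = r
  rw [blurringFull, hr]
  ext x y
  simp only [partialTrace, symmetrise, Matrix.of_apply, Matrix.smul_apply, Matrix.sum_apply,
    permUnitary_mul_mul, smul_eq_mul]
  rw [Fintype.sum_prod_type, Finset.sum_comm' (t' := Finset.univ) (s' := fun _ => Finset.univ)
    (by simp), Finset.sum_congr rfl fun z _ => Finset.mul_sum _ _ _]
  refine Finset.sum_congr rfl fun z _ => Finset.sum_congr rfl fun π _ => ?_
  congr 1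
  have h1 : (mixMat π z * A * (mixMat π z).conjTranspose) x y =
      ∑ q, star (mixMat π z y q) * ∑ p, mixMat π z x p * A p q := by
    rw [Matrix.mul_apply]
    refine Finset.sum_congr rfl fun q _ => ?_
    rw [Matrix.mul_apply, Matrix.conjTranspose_apply, mul_comm]
  have h2 : ∀ q, star (mixMat π z y q) = mixMat π z y q := fun q => by
    simp only [mixMat, Matrix.of_apply]
    split_ifs <;> simp
  rw [h1]
  simp only [h2, sum_mixMat_mul]
  simp only [tensorMat, tensorPowMat, Matrix.of_apply, Function.comp_apply, prod_single_zero]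
  by_cases hx : ZeroTail π x z <;> by_cases hy : ZeroTail π y z
  · rw [if_pos ⟨hx, hy⟩, mul_one, if_pos hx, if_pos hy]; rfl
  · rw [if_neg fun h => hy h.2, if_neg hy, mul_zero]
  · rw [if_neg fun h => hx h.1, if_neg hx, mul_zero, ite_self]
  · rw [if_neg fun h => hx h.1, if_neg hy, mul_zero]

/-- `U_n` as a bounded operator. -/
def embeddingL (m n : ℕ) : symSpace (m + 1) n →L[ℂ] Fock m :=
  (embedding m n).toContinuousLinearMap

/-- `U_n†`. -/
def embeddingAdj (m n : ℕ) : Fock m →L[ℂ] symSpace (m + 1) n :=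
  ContinuousLinearMap.adjoint (𝕜 := ℂ) (E := symSpace (m + 1) n) (F := Fock m) (embeddingL m n)

/-- The Kraus operators of the lifted blurring map. -/
def mixOp {m n r : ℕ} (p : Equiv.Perm (Fin (n + r)) × (Fin r → Fin (m + 1))) : Op (Fin m → ℕ) :=
  ((Real.sqrt (n + r).factorial : ℂ)⁻¹) •
    (embeddingL m n ∘L symProj (m + 1) n ∘L Matrix.toEuclideanCLM (𝕜 := ℂ) (mixMat p.1 p.2) ∘L
      (symSpace (m + 1) n).subtypeL ∘L embeddingAdj m n)

theorem inner_coe_adjoint {E F : Type*} [NormedAddCommGroup E] [InnerProductSpace ℂ E]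
    [NormedAddCommGroup F] [InnerProductSpace ℂ F] [CompleteSpace F] (S : Submodule ℂ E)
    [CompleteSpace S] (U : S →L[ℂ] F) (v : S) (w : F) :
    ⟪(v : E), (ContinuousLinearMap.adjoint (𝕜 := ℂ) (E := S) (F := F) U w : E)⟫_ℂ = ⟪U v, w⟫_ℂ := by
  rw [← ContinuousLinearMap.adjoint_inner_right (𝕜 := ℂ) (E := S) (F := F) U v w]
  rfl

theorem inner_embeddingAdj {m n : ℕ} (v : symSpace (m + 1) n) (w : Fock m) :
    ⟪(v : TensorSpace (m + 1) n), (embeddingAdj m n w : TensorSpace (m + 1) n)⟫_ℂ =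
      ⟪embeddingL m n v, w⟫_ℂ :=
  inner_coe_adjoint (symSpace (m + 1) n) (embeddingL m n) v w

theorem embeddingAdj_inner {m n : ℕ} (v : symSpace (m + 1) n) (w : Fock m) :
    ⟪(embeddingAdj m n w : TensorSpace (m + 1) n), (v : TensorSpace (m + 1) n)⟫_ℂ =
      ⟪w, embeddingL m n v⟫_ℂ := by
  rw [← inner_conj_symm, inner_embeddingAdj, inner_conj_symm]

theorem inner_symProj {d n : ℕ} (v : symSpace d n) (w : TensorSpace d n) :
    ⟪(v : TensorSpace d n), (symProj d n w : TensorSpace d n)⟫_ℂ = ⟪(v : TensorSpace d n), w⟫_ℂ :=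
  Submodule.inner_orthogonalProjectionOnto_eq_of_mem_left v w

theorem inner_mixOp {m n r : ℕ} (p : Equiv.Perm (Fin (n + r)) × (Fin r → Fin (m + 1)))
    (v w : Fock m) :
    ⟪v, mixOp p w⟫_ℂ = ((Real.sqrt (n + r).factorial : ℂ)⁻¹) *
      ⟪(embeddingAdj m n v : TensorSpace (m + 1) n),
        Matrix.toEuclideanCLM (𝕜 := ℂ) (mixMat p.1 p.2)
          (embeddingAdj m n w : TensorSpace (m + 1) n)⟫_ℂ := by
  simp only [mixOp, smul_apply, inner_smul_right,
    ContinuousLinearMap.comp_apply, ← embeddingAdj_inner, inner_symProj]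
  rfl

theorem adjoint_toEuclideanCLM {m n : ℕ} (A : TensorMat m n) :
    ContinuousLinearMap.adjoint (Matrix.toEuclideanCLM (𝕜 := ℂ) A) =
      Matrix.toEuclideanCLM (𝕜 := ℂ) A.conjTranspose :=
  (map_star (Matrix.toEuclideanCLM (n := Fin n → Fin m) (𝕜 := ℂ)) A).symm

theorem adjoint_mixOp {m n r : ℕ} (p : Equiv.Perm (Fin (n + r)) × (Fin r → Fin (m + 1))) :
    ContinuousLinearMap.adjoint (mixOp p) = ((Real.sqrt (n + r).factorial : ℂ)⁻¹) •
      (embeddingL m n ∘L symProj (m + 1) n ∘L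
        Matrix.toEuclideanCLM (𝕜 := ℂ) (mixMat p.1 p.2).conjTranspose ∘L
        (symSpace (m + 1) n).subtypeL ∘L embeddingAdj m n) := by
  refine ContinuousLinearMap.ext fun w => ext_inner_left ℂ fun v => ?_
  rw [ContinuousLinearMap.adjoint_inner_right, ← inner_conj_symm, inner_mixOp, map_mul,
    inner_conj_symm, ← adjoint_toEuclideanCLM]
  simp only [smul_apply, inner_smul_right,
    ContinuousLinearMap.comp_apply, ← embeddingAdj_inner, inner_symProj]
  rw [ContinuousLinearMap.adjoint_inner_right, map_inv₀, Complex.conj_ofReal]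
  rfl

theorem liftedBlurring_eq_kraus (m n : ℕ) (δ : ℝ) (X : Op (Fin m → ℕ)) :
    liftedBlurring m n δ X = kraus (mixOp (m := m) (n := n) (r := ⌊δ * n⌋₊)) X := by
  rw [kraus, tsum_fintype]
  have hc : (((n + ⌊δ * n⌋₊).factorial : ℂ)⁻¹) =
      (Real.sqrt (n + ⌊δ * n⌋₊).factorial : ℂ)⁻¹ * (Real.sqrt (n + ⌊δ * n⌋₊).factorial : ℂ)⁻¹ := by
    rw [← mul_inv, ← Complex.ofReal_mul, Real.mul_self_sqrt (by positivity),
      Complex.ofReal_natCast]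
  change embeddingL m n ∘L blurring m n δ (embeddingAdj m n ∘L X ∘L embeddingL m n) ∘L
    embeddingAdj m n = _
  rw [blurring, blurringFull_eq_sum, map_sum]
  simp only [ContinuousLinearMap.finsetSum_comp, ContinuousLinearMap.comp_finsetSum]
  refine Finset.sum_congr rfl fun p _ => ?_
  rw [adjoint_mixOp, mixOp, map_smul, map_mul, map_mul, StarAlgEquiv.apply_symm_apply, hc]
  simp only [ContinuousLinearMap.smul_comp, ContinuousLinearMap.comp_smul, smul_smul]
  rfl

theorem norm_embeddingAdj_le {m n : ℕ} (v : Fock m) : ‖embeddingAdj m n v‖ ≤ ‖v‖ := by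
  have h : ‖embeddingAdj m n‖ ≤ 1 := by
    rw [embeddingAdj, LinearIsometryEquiv.norm_map]
    exact (embedding m n).norm_toContinuousLinearMap_le
  simpa using (ContinuousLinearMap.le_opNorm _ v).trans
    (mul_le_mul_of_nonneg_right h (norm_nonneg _))

theorem norm_mixOp_sq_le {m n r : ℕ} (p : Equiv.Perm (Fin (n + r)) × (Fin r → Fin (m + 1)))
    (v : Fock m) :
    ‖mixOp p v‖ ^ 2 ≤ ((n + r).factorial : ℝ)⁻¹ * ∑ x, if ZeroTail p.1 x p.2 then
      ‖(embeddingAdj m n v : TensorSpace (m + 1) n) (mixHead p.1 x p.2)‖ ^ 2 else 0 := by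
  set w : TensorSpace (m + 1) n := (embeddingAdj m n v : TensorSpace (m + 1) n)
  have h1 : ‖mixOp p v‖ = ‖(Real.sqrt (n + r).factorial : ℂ)⁻¹‖ *
      ‖symProj (m + 1) n (Matrix.toEuclideanCLM (𝕜 := ℂ) (mixMat p.1 p.2) w)‖ := by
    rw [← (embedding m n).norm_map, ← norm_smul]
    rfl
  rw [h1, mul_pow, norm_inv, inv_pow, Complex.norm_real, Real.norm_eq_abs, sq_abs,
    Real.sq_sqrt (by positivity)]
  refine mul_le_mul_of_nonneg_left ?_ (by positivity)
  calc _ ≤ ‖Matrix.toEuclideanCLM (𝕜 := ℂ) (mixMat p.1 p.2) w‖ ^ 2 := by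
        gcongr
        exact Submodule.norm_orthogonalProjectionOnto_apply_le _ _
    _ = _ := by
        rw [EuclideanSpace.norm_sq_eq]
        refine Finset.sum_congr rfl fun x _ => ?_
        rw [Matrix.ofLp_toEuclideanCLM, Matrix.mulVec, dotProduct, sum_mixMat_mul]
        split_ifs <;> simp

theorem isKraus_mixOp {m n r : ℕ} : IsKraus (mixOp (m := m) (n := n) (r := r)) := by
  intro v s
  set w : TensorSpace (m + 1) n := (embeddingAdj m n v : TensorSpace (m + 1) n) with hw
  -- Squared amplitudes of w ⊗ |0…0⟩. Summing over x and z runs through all strings of length n + r,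
  -- so each π contributes at most ‖w‖²/(n+r)!.
  let g : (Fin (n + r) → Fin (m + 1)) → ℝ := fun y =>
    if ∀ i : Fin r, y (Fin.natAdd n i) = 0 then ‖w fun i => y (Fin.castAdd r i)‖ ^ 2 else 0
  have hg : ∑ y, g y = ‖w‖ ^ 2 := by
    rw [← (Fin.appendEquiv n r).sum_comp, Fintype.sum_prod_type, EuclideanSpace.norm_sq_eq]
    refine Finset.sum_congr rfl fun x _ => ?_
    rw [Finset.sum_eq_single (0 : Fin r → Fin (m + 1))]
    · simp [g, Fin.appendEquiv]
    · intro z _ hz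
      have : ¬ ∀ i, z i = 0 := fun h => hz (funext h)
      simp [g, Fin.appendEquiv, this]
    · simp
  calc ∑ p ∈ s, ‖mixOp p v‖ ^ 2 ≤ ∑ p, ‖mixOp (m := m) (n := n) (r := r) p v‖ ^ 2 :=
        Finset.sum_le_univ_sum_of_nonneg fun _ => by positivity
    _ ≤ ∑ p : Equiv.Perm (Fin (n + r)) × (Fin r → Fin (m + 1)), ((n + r).factorial : ℝ)⁻¹ *
          ∑ x, g (Fin.append x p.2 ∘ p.1) :=
        Finset.sum_le_sum fun p _ => norm_mixOp_sq_le p v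
    _ = ∑ π : Equiv.Perm (Fin (n + r)), ((n + r).factorial : ℝ)⁻¹ * ‖w‖ ^ 2 := by
        rw [Fintype.sum_prod_type]
        refine Finset.sum_congr rfl fun π _ => ?_
        rw [← Finset.mul_sum, Finset.sum_comm, ← Fintype.sum_prod_type',
          ← hg]
        refine congrArg _ (((Fin.appendEquiv n r).sum_comp (fun y => g (y ∘ π))).trans ?_)
        exact (Equiv.arrowCongr π.symm (Equiv.refl (Fin (m + 1)))).sum_comp g
    _ = ‖w‖ ^ 2 := by
        rw [Finset.sum_const, Finset.card_univ, Fintype.card_perm, Fintype.card_fin, nsmul_eq_mul,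
          mul_inv_cancel_left₀ (by positivity)]
    _ ≤ ‖v‖ ^ 2 := by
        gcongr
        exact norm_embeddingAdj_le v

/-! ### Matrix elements of the Kraus operators -/

/-- The type with `h i` occurrences of the symbol `i + 1` and total length `n`. -/
def fullType {m : ℕ} (n : ℕ) (h : Fin m → ℕ) : Fin (m + 1) → ℕ := Fin.cons (n - ∑ i, h i) h

theorem fullType_mem_types {m n : ℕ} {h : Fin m → ℕ} (hn : ∑ i, h i ≤ n) :
    fullType n h ∈ types (m + 1) n := by
  simp only [types, Finset.mem_piAntidiag, Fin.sum_univ_succ, fullType]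
  simp [Nat.sub_add_cancel hn]

theorem tail_fullType {m n : ℕ} (h : Fin m → ℕ) : Fin.tail (fullType n h) = h := by
  simp [fullType]

theorem sum_tail_le {m n : ℕ} {t : Fin (m + 1) → ℕ} (ht : t ∈ types (m + 1) n) :
    ∑ i, Fin.tail t i ≤ n := by
  simp only [types, Finset.mem_piAntidiag, Fin.sum_univ_succ] at ht
  exact le_trans (Nat.le_add_left _ _) ht.1.le

theorem eq_fullType_iff {m n : ℕ} {t : Fin (m + 1) → ℕ} (ht : t ∈ types (m + 1) n)
    (h : Fin m → ℕ) : Fin.tail t = h ↔ ∑ i, h i ≤ n ∧ t = fullType n h := by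
  constructor
  · rintro rfl
    exact ⟨sum_tail_le ht, tail_injOn_types m n ht (fullType_mem_types (sum_tail_le ht))
      (tail_fullType _).symm⟩
  · rintro ⟨-, rfl⟩
    exact tail_fullType h

theorem typeOf_comp_perm {d n : ℕ} (x : Fin n → Fin d) (π : Equiv.Perm (Fin n)) :
    typeOf (x ∘ π) = typeOf x := by
  funext a
  exact Finset.card_equiv π (by simp)

theorem typeKet_mem_symSpace {d n : ℕ} (t : Fin d → ℕ) : typeKet n t ∈ symSpace d n := by
  intro π
  ext x
  rw [permUnitary_apply]
  simp [typeKet, typeClass, Finset.sum_apply, typeOf_comp_perm, Pi.single_apply]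

theorem coeff_embedding {m n : ℕ} (v : symSpace (m + 1) n) (h : Fin m → ℕ) :
    coeff (embeddingL m n v) h = if ∑ i, h i ≤ n then
      ⟪typeKet n (fullType n h), (v : TensorSpace (m + 1) n)⟫_ℂ else 0 := by
  have h1 : embeddingL m n v = ∑ t ∈ types (m + 1) n,
    ⟪typeKet n t, (v : TensorSpace (m + 1) n)⟫_ℂ • ket (Fin.tail t) := rfl
  rw [← inner_ket_left, h1, inner_sum]
  simp only [inner_smul_right, inner_ket_ket]
  split_ifs with hn
  · rw [Finset.sum_eq_single_of_mem _ (fullType_mem_types hn)]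
    · simp [tail_fullType]
    · intro t ht hne
      rw [if_neg, mul_zero]
      exact fun he => hne ((eq_fullType_iff ht h).mp he.symm).2
  · refine Finset.sum_eq_zero fun t ht => ?_
    rw [if_neg, mul_zero]
    exact fun he => hn ((eq_fullType_iff ht h).mp he.symm).1

theorem embeddingAdj_ket {m n : ℕ} (h : Fin m → ℕ) :
    (embeddingAdj m n (ket h) : TensorSpace (m + 1) n) =
      if ∑ i, h i ≤ n then typeKet n (fullType n h) else 0 := by
  have key : embeddingAdj m n (ket h) =
      if ∑ i, h i ≤ n then (⟨typeKet n (fullType n h), typeKet_mem_symSpace _⟩ :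
        symSpace (m + 1) n) else 0 := by
    refine ext_inner_left ℂ fun v => ?_
    refine (inner_embeddingAdj v (ket h)).trans ?_
    rw [inner_ket_right, coeff_embedding]
    split_ifs
    · exact inner_conj_symm _ _
    · exact (star_zero ℂ).trans (inner_zero_right _).symm
  rw [key]
  split_ifs <;> rfl

theorem typeOf_append {d n r : ℕ} (x : Fin n → Fin d) (z : Fin r → Fin d) :
    typeOf (Fin.append x z) = typeOf x + typeOf z := by
  funext a
  simp only [typeOf, Pi.add_apply, Finset.card_filter, Fin.sum_univ_add, Fin.append_left,
    Fin.append_right]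

/-- Permuting a string keeps its type, and the zero tail has no nonzero symbols. This conservation
law yields the selection rule s = h + j, with j read off from z. -/
theorem tail_typeOf_mixHead {m n r : ℕ} {π : Equiv.Perm (Fin (n + r))} {x : Fin n → Fin (m + 1)}
    {z : Fin r → Fin (m + 1)} (h : ZeroTail π x z) :
    Fin.tail (typeOf (mixHead π x z)) = Fin.tail (typeOf x) + Fin.tail (typeOf z) := by
  have h1 : Fin.append x z ∘ π = Fin.append (mixHead π x z) (0 : Fin r → Fin (m + 1)) := by
    rw [← Fin.append_castAdd_natAdd (f := Fin.append x z ∘ π)]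
    congr 1
    exact funext h
  have h2 := typeOf_comp_perm (Fin.append x z) π
  rw [h1, typeOf_append, typeOf_append] at h2
  have h3 : Fin.tail (typeOf (0 : Fin r → Fin (m + 1))) = 0 := by
    funext i
    simp [Fin.tail, typeOf, (Fin.succ_ne_zero i).symm]
  have h4 := congrArg (fun t => Fin.tail t) h2
  change Fin.tail (typeOf (mixHead π x z)) + Fin.tail (typeOf (0 : Fin r → Fin (m + 1))) = _ at h4
  rwa [h3, add_zero] at h4

theorem sum_typeClass_mixMat {m n r : ℕ} (π : Equiv.Perm (Fin (n + r)))
    (z : Fin r → Fin (m + 1)) {h s : Fin m → ℕ} (hs : ∑ i, s i ≤ n) {x : Fin n → Fin (m + 1)}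
    (hx : x ∈ typeClass n (fullType n h)) :
    ∑ p ∈ typeClass n (fullType n s), mixMat π z x p =
      if h + Fin.tail (typeOf z) = s ∧ ZeroTail π x z then (1 : ℂ) else 0 := by
  have hx' : Fin.tail (typeOf x) = h := by
    rw [(Finset.mem_filter.mp hx).2, tail_fullType]
  have h1 := sum_mixMat_mul π z x
    fun p => if p ∈ typeClass n (fullType n s) then (1 : ℂ) else 0
  simp only [mul_ite, mul_one, mul_zero, Finset.sum_ite_mem, Finset.univ_inter] at h1
  rw [h1]
  by_cases hz : ZeroTail π x z
  · have : mixHead π x z ∈ typeClass n (fullType n s) ↔ h + Fin.tail (typeOf z) = s := by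
      rw [← hx', ← tail_typeOf_mixHead hz, eq_fullType_iff (typeOf_mem_types _)]
      simp [typeClass, hs]
    simp only [this, hz, and_true, if_true]
  · simp [hz]

/-- The number of strings `x` of type `h` for which `(x, z) ∘ π` has vanishing last entries. -/
def mixCount {m n r : ℕ} (p : Equiv.Perm (Fin (n + r)) × (Fin r → Fin (m + 1))) (h : Fin m → ℕ) :
    ℕ :=
  ((typeClass n (fullType n h)).filter fun x => ZeroTail p.1 x p.2).card

theorem inner_mixOp_ket {m n r : ℕ} (p : Equiv.Perm (Fin (n + r)) × (Fin r → Fin (m + 1)))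
    {h s : Fin m → ℕ} (hh : ∑ i, h i ≤ n) (hs : ∑ i, s i ≤ n) :
    ⟪ket h, mixOp p (ket s)⟫_ℂ = (((Real.sqrt (n + r).factorial)⁻¹ *
      ((Real.sqrt (typeClass n (fullType n h)).card)⁻¹ *
        (Real.sqrt (typeClass n (fullType n s)).card)⁻¹ *
        if h + Fin.tail (typeOf p.2) = s then (mixCount p h : ℝ) else 0) : ℝ) : ℂ) := by
  rw [inner_mixOp, embeddingAdj_ket, embeddingAdj_ket, if_pos hh, if_pos hs]
  have h1 : ∀ x, Matrix.toEuclideanCLM (𝕜 := ℂ) (mixMat p.1 p.2) (typeKet n (fullType n s)) x =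
      (Real.sqrt (typeClass n (fullType n s)).card : ℂ)⁻¹ *
        ∑ q ∈ typeClass n (fullType n s), mixMat p.1 p.2 x q := by
    intro x
    have h2 : ∀ q, typeKet n (fullType n s) q = if q ∈ typeClass n (fullType n s) then
        (Real.sqrt (typeClass n (fullType n s)).card : ℂ)⁻¹ else 0 := fun q => by
      simp [typeKet, Pi.single_apply]
    rw [Matrix.ofLp_toEuclideanCLM, Matrix.mulVec, dotProduct, Finset.mul_sum]
    simp only [h2, mul_ite, mul_zero, Finset.sum_ite_mem, Finset.univ_inter]
    exact Finset.sum_congr rfl fun q _ => mul_comm _ _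
  have h3 : ⟪typeKet n (fullType n h), Matrix.toEuclideanCLM (𝕜 := ℂ) (mixMat p.1 p.2)
      (typeKet n (fullType n s))⟫_ℂ = (Real.sqrt (typeClass n (fullType n h)).card : ℂ)⁻¹ *
        ∑ x ∈ typeClass n (fullType n h), Matrix.toEuclideanCLM (𝕜 := ℂ) (mixMat p.1 p.2)
          (typeKet n (fullType n s)) x := by
    rw [typeKet, inner_smul_left, sum_inner]
    simp [EuclideanSpace.inner_single_left]
  rw [h3, Finset.sum_congr rfl fun x hx => by rw [h1, sum_typeClass_mixMat p.1 p.2 hs hx],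
    ← Finset.mul_sum]
  by_cases he : h + Fin.tail (typeOf p.2) = s
  · simp only [he, true_and, if_true, Finset.sum_boole, mixCount]
    push_cast
    ring
  · simp [he]

/-! ### Counting strings of a given type -/

theorem exists_typeOf_eq {d n : ℕ} {t : Fin d → ℕ} (ht : t ∈ types d n) :
    ∃ x : Fin n → Fin d, typeOf x = t := by
  have hsum : ∑ a, t a = n := (Finset.mem_piAntidiag.mp ht).1
  let e : Fin n ≃ Σ a, Fin (t a) := (finCongr hsum.symm).trans finSigmaFinEquiv.symm
  refine ⟨fun i => (e i).1, funext fun a => ?_⟩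
  rw [typeOf, ← Fintype.card_subtype, Fintype.card_congr (e.subtypeEquiv
    (q := fun p : Σ a, Fin (t a) => p.1 = a) fun i => Iff.rfl),
    Fintype.card_congr (Equiv.sigmaSubtype (β := fun a => Fin (t a)) a), Fintype.card_fin]

/-- Orbit–stabiliser: each fibre of π ↦ x ∘ π is a translate of the stabiliser of x, which has ∏ₐ
tₐ! elements. -/
theorem card_typeClass_mul {d n : ℕ} {t : Fin d → ℕ} (ht : t ∈ types d n) :
    (typeClass n t).card * ∏ a, (t a).factorial = n.factorial := by
  obtain ⟨x, rfl⟩ := exists_typeOf_eq ht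
  have hst : ∀ y ∈ typeClass n (typeOf x),
      (Finset.univ.filter fun π : Equiv.Perm (Fin n) => x ∘ π = y).card =
        ∏ a, (typeOf x a).factorial := by
    intro y hy
    obtain ⟨σ, rfl⟩ := exists_perm_of_typeOf_eq (Finset.mem_filter.mp hy).2
    have h1 := DomMulAct.stabilizer_card x
    simp only [Fintype.card_subtype] at h1
    rw [show (∏ a, (typeOf x a).factorial) = _ from h1.symm]
    refine Finset.card_equiv (Equiv.mulRight σ⁻¹) fun π => ?_
    simp only [Finset.mem_filter, Finset.mem_univ, true_and, Equiv.coe_mulRight,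
      Equiv.Perm.coe_mul, ← Function.comp_assoc]
    constructor
    · intro h
      rw [h]
      ext i
      simp
    · intro h
      funext i
      have := congrFun h (σ i)
      simpa using this
  have h2 := Finset.card_eq_sum_card_fiberwise (f := fun π : Equiv.Perm (Fin n) => x ∘ π)
    (s := Finset.univ) (t := typeClass n (typeOf x))
    (fun π _ => by simp [typeClass, typeOf_comp_perm])
  rw [Finset.sum_congr rfl hst, Finset.sum_const, smul_eq_mul, Finset.card_univ,
    Fintype.card_perm, Fintype.card_fin] at h2
  exact h2.symm

theorem card_typeClass_fullType {m n : ℕ} {h : Fin m → ℕ} (hn : ∑ i, h i ≤ n) :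
    (typeClass n (fullType n h)).card * ∏ i, (h i).factorial = n.descFactorial (∑ i, h i) := by
  have h1 := card_typeClass_mul (fullType_mem_types hn)
  rw [Fin.prod_univ_succ, ← Nat.factorial_mul_descFactorial hn] at h1
  simp only [fullType, Fin.cons_zero, Fin.cons_succ] at h1 ⊢
  rw [mul_left_comm] at h1
  exact Nat.eq_of_mul_eq_mul_left (Nat.factorial_pos _) h1

theorem filter_tail_typeOf {m r : ℕ} {j : Fin m → ℕ} (hr : ∑ i, j i ≤ r) :
    (Finset.univ.filter fun z : Fin r → Fin (m + 1) => Fin.tail (typeOf z) = j) =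
      typeClass r (fullType r j) := by
  ext z
  simp [typeClass, eq_fullType_iff (typeOf_mem_types z), hr]

theorem card_tail_typeOf {m : ℕ} (r : ℕ) (j : Fin m → ℕ) :
    (Finset.univ.filter fun z : Fin r → Fin (m + 1) => Fin.tail (typeOf z) = j).card *
      ∏ i, (j i).factorial = r.descFactorial (∑ i, j i) := by
  by_cases hr : ∑ i, j i ≤ r
  · rw [filter_tail_typeOf hr, card_typeClass_fullType hr]
  -- If j has more than r symbols, both sides vanish.
  · rw [Nat.descFactorial_of_lt (not_le.mp hr), Finset.filter_eq_empty_iff.mpr]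
    · simp
    · rintro z - rfl
      exact hr (sum_tail_le (typeOf_mem_types z))

theorem card_support {m n : ℕ} (x : Fin n → Fin (m + 1)) :
    (Finset.univ.filter fun i => x i ≠ 0).card = ∑ a, Fin.tail (typeOf x) a := by
  have h := (Finset.mem_piAntidiag.mp (typeOf_mem_types x)).1
  rw [Fin.sum_univ_succ] at h
  have h2 := Finset.card_filter_add_card_filter_not (s := Finset.univ) fun i => x i = 0
  rw [Finset.card_univ, Fintype.card_fin] at h2
  have h3 : typeOf x 0 = (Finset.univ.filter fun i => x i = 0).card := rfl
  change typeOf x 0 + ∑ a, Fin.tail (typeOf x) a = n at h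
  simp only [ne_eq]
  omega

theorem card_support_of_mem {m n : ℕ} {h : Fin m → ℕ} {x : Fin n → Fin (m + 1)}
    (hx : x ∈ typeClass n (fullType n h)) :
    (Finset.univ.filter fun i => x i ≠ 0).card = ∑ i, h i := by
  rw [card_support, (Finset.mem_filter.mp hx).2, tail_fullType]

/-- Double count pairs (position, string) with a nonzero symbol at the position; by transpositions,
every position has the same count. -/
theorem card_typeClass_ne_zero_mul {m n : ℕ} (h : Fin m → ℕ) (i : Fin n) :
    ((typeClass n (fullType n h)).filter fun x => x i ≠ 0).card * n =
      (∑ a, h a) * (typeClass n (fullType n h)).card := by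
  have h1 : ∀ i', ((typeClass n (fullType n h)).filter fun x => x i' ≠ 0).card =
      ((typeClass n (fullType n h)).filter fun x => x i ≠ 0).card := by
    intro i'
    refine Finset.card_equiv (Equiv.arrowCongr (Equiv.swap i i') (Equiv.refl _)) fun x => ?_
    have : (Equiv.arrowCongr (Equiv.swap i i') (Equiv.refl (Fin (m + 1)))) x =
        x ∘ Equiv.swap i i' := by
      ext; simp [Equiv.arrowCongr]
    rw [this]
    simp [typeClass, typeOf_comp_perm]
  have h2 : ∑ i', ((typeClass n (fullType n h)).filter fun x => x i' ≠ 0).card =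
      ∑ x ∈ typeClass n (fullType n h), (Finset.univ.filter fun i' => x i' ≠ 0).card := by
    simp only [Finset.card_filter]
    exact Finset.sum_comm
  rw [Finset.sum_congr rfl fun x hx => card_support_of_mem hx,
    Finset.sum_congr rfl fun i' _ => h1 i', Finset.sum_const, Finset.sum_const, Finset.card_univ, Fintype.card_fin, smul_eq_mul,
    smul_eq_mul] at h2
  rw [mul_comm, h2, mul_comm]

/-- The pairs of strings of types `h` and `k` with intersecting supports. -/
def meetingPairs {m : ℕ} (n : ℕ) (h k : Fin m → ℕ) :
    Finset ((Fin n → Fin (m + 1)) × (Fin n → Fin (m + 1))) :=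
  (typeClass n (fullType n h) ×ˢ typeClass n (fullType n k)).filter
    fun p => ∃ i, p.1 i ≠ 0 ∧ p.2 i ≠ 0

/-- Union bound over the meeting position: each of the n positions accounts for a fraction
(|h|/n)(|k|/n) of all pairs, so meeting pairs are a fraction at most |h||k|/n. -/
theorem card_meetingPairs_mul_le {m : ℕ} (n : ℕ) (h k : Fin m → ℕ) :
    (meetingPairs n h k).card * n ≤ (∑ a, h a) * (∑ a, k a) *
      ((typeClass n (fullType n h)).card * (typeClass n (fullType n k)).card) := by
  rcases Nat.eq_zero_or_pos n with rfl | hn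
  · simp
  have hsub : meetingPairs n h k ⊆ Finset.univ.biUnion fun i =>
      ((typeClass n (fullType n h)).filter fun x => x i ≠ 0) ×ˢ
        ((typeClass n (fullType n k)).filter fun x => x i ≠ 0) := by
    rintro p hp
    simp only [meetingPairs, Finset.mem_filter, Finset.mem_product] at hp
    obtain ⟨⟨h1, h2⟩, i, h3, h4⟩ := hp
    simp only [Finset.mem_biUnion, Finset.mem_univ, true_and, Finset.mem_product,
      Finset.mem_filter]
    exact ⟨i, ⟨h1, h3⟩, h2, h4⟩
  have h1 := (Finset.card_le_card hsub).trans Finset.card_biUnion_le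
  simp only [Finset.card_product] at h1
  refine Nat.le_of_mul_le_mul_right ?_ hn
  calc _ ≤ (∑ i : Fin n, ((typeClass n (fullType n h)).filter fun x => x i ≠ 0).card *
        ((typeClass n (fullType n k)).filter fun x => x i ≠ 0).card) * n * n := by gcongr
    _ = ∑ i : Fin n, ((∑ a, h a) * (typeClass n (fullType n h)).card) *
        ((∑ a, k a) * (typeClass n (fullType n k)).card) := by
      rw [mul_assoc, Finset.sum_mul]
      refine Finset.sum_congr rfl fun i _ => ?_
      rw [← card_typeClass_ne_zero_mul h i, ← card_typeClass_ne_zero_mul k i]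
      ring
    _ = _ := by
      rw [Finset.sum_const, Finset.card_univ, Fintype.card_fin, smul_eq_mul]
      ring

/-! ### Counting permutations -/

/-- Induction on S, double counting pairs (π, s') with s' ∉ S and π mapping S ∪ {s'} into A. Each π
that maps S into A admits |A| - |S| such s', and all s' have the same number of π. -/
theorem card_perm_maps_mul {α : Type*} [Fintype α] [DecidableEq α] (A S : Finset α) :
    (Finset.univ.filter fun π : Equiv.Perm α => ∀ s ∈ S, π s ∈ A).card *
      (Fintype.card α).descFactorial S.card =
    (Fintype.card α).factorial * A.card.descFactorial S.card := by
  induction S using Finset.induction_on with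
  | empty => simp [Fintype.card_perm]
  | insert s S hs ih =>
    have hsymm : ∀ s' ∈ Sᶜ,
        (Finset.univ.filter fun π : Equiv.Perm α => ∀ c ∈ insert s' S, π c ∈ A).card =
          (Finset.univ.filter fun π : Equiv.Perm α => ∀ c ∈ insert s S, π c ∈ A).card := by
      intro s' hs'
      rw [Finset.mem_compl] at hs'
      refine Finset.card_equiv (Equiv.mulRight (Equiv.swap s s')) fun π => ?_
      have hfix : ∀ c ∈ S, Equiv.swap s s' c = c := fun c hc =>
        Equiv.swap_apply_of_ne_of_ne (fun e => hs (e ▸ hc)) fun e => hs' (e ▸ hc)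
      simp only [Finset.mem_filter, Finset.mem_univ, true_and, Finset.forall_mem_insert,
        Equiv.coe_mulRight, Equiv.Perm.mul_apply, Equiv.swap_apply_left]
      exact and_congr_right fun _ => forall₂_congr fun c hc => by rw [hfix c hc]
    have hcount : ∑ s' ∈ Sᶜ,
        (Finset.univ.filter fun π : Equiv.Perm α => ∀ c ∈ insert s' S, π c ∈ A).card =
        (Finset.univ.filter fun π : Equiv.Perm α => ∀ c ∈ S, π c ∈ A).card *
          (A.card - S.card) := by
      have h1 : ∀ π : Equiv.Perm α, (∀ c ∈ S, π c ∈ A) →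
          (Sᶜ.filter fun s' => π s' ∈ A).card = A.card - S.card := by
        intro π hπ
        have h2 : (Sᶜ.filter fun s' => π s' ∈ A).map π.toEmbedding = A \ S.map π.toEmbedding := by
          ext a
          simp only [Finset.mem_map, Finset.mem_filter, Finset.mem_compl, Finset.mem_sdiff,
            Equiv.coe_toEmbedding]
          constructor
          · rintro ⟨c, ⟨hc, hA⟩, rfl⟩
            exact ⟨hA, fun ⟨c', hc', he⟩ => hc (π.injective he ▸ hc')⟩
          · rintro ⟨hA, hn⟩
            exact ⟨π.symm a, ⟨fun hc => hn ⟨_, hc, by simp⟩, by simpa using hA⟩, by simp⟩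
        rw [← Finset.card_map π.toEmbedding, h2, Finset.card_sdiff_of_subset, Finset.card_map]
        intro a ha
        obtain ⟨c, hc, rfl⟩ := Finset.mem_map.mp ha
        exact hπ c hc
      rw [← smul_eq_mul, ← Finset.sum_const, Finset.sum_congr rfl fun π hπ =>
        (h1 π (Finset.mem_filter.mp hπ).2).symm]
      simp only [Finset.card_filter]
      rw [Finset.sum_comm, Finset.sum_filter]
      refine Finset.sum_congr rfl fun π _ => ?_
      split_ifs with hπ
      · exact Finset.sum_congr rfl fun c _ => by simp [and_iff_left hπ]
      · exact Finset.sum_eq_zero fun c _ => by simp [hπ]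
    rw [Finset.sum_congr rfl hsymm, Finset.sum_const, smul_eq_mul, Finset.card_compl] at hcount
    rw [Finset.card_insert_of_notMem hs, Nat.descFactorial_succ, Nat.descFactorial_succ]
    calc _ = ((Fintype.card α - S.card) *
        (Finset.univ.filter fun π : Equiv.Perm α => ∀ c ∈ insert s S, π c ∈ A).card) *
          (Fintype.card α).descFactorial S.card := by ring
      _ = _ := by
        rw [hcount, mul_right_comm, ih]
        ring

/-- The probability that `u` given points of `Fin (n + r)` are sent to the first `n`. -/
def headProb (n r u : ℕ) : ℝ := n.descFactorial u / (n + r).descFactorial u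

theorem headProb_nonneg (n r u : ℕ) : 0 ≤ headProb n r u := by unfold headProb; positivity

theorem headProb_le_one (n r u : ℕ) : headProb n r u ≤ 1 :=
  div_le_one_of_le₀ (by exact_mod_cast Nat.descFactorial_le u (Nat.le_add_right n r))
    (by positivity)

/-- Pass to inverses: π sends no tail position into S exactly when π⁻¹ maps S into the first n
positions. -/
theorem card_perm_avoid {n r : ℕ} (S : Finset (Fin (n + r))) :
    ((Finset.univ.filter fun π : Equiv.Perm (Fin (n + r)) =>
      ∀ i : Fin r, π (Fin.natAdd n i) ∉ S).card : ℝ) = (n + r).factorial * headProb n r S.card := by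
  have hA : (Finset.univ.map (Fin.castAddEmb r : Fin n ↪ Fin (n + r))).card = n := by simp
  have h1 := card_perm_maps_mul (Finset.univ.map (Fin.castAddEmb r : Fin n ↪ Fin (n + r))) S
  rw [hA, Fintype.card_fin] at h1
  have h2 : (Finset.univ.filter fun π : Equiv.Perm (Fin (n + r)) =>
      ∀ i : Fin r, π (Fin.natAdd n i) ∉ S).card = (Finset.univ.filter fun π :
        Equiv.Perm (Fin (n + r)) => ∀ s ∈ S, π s ∈
          Finset.univ.map (Fin.castAddEmb r : Fin n ↪ Fin (n + r))).card := by
    refine Finset.card_equiv (Equiv.inv _) fun π => ?_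
    simp only [Finset.mem_filter, Finset.mem_univ, true_and, Equiv.inv_apply, Finset.mem_map]
    constructor
    · intro h s hs
      have : ∀ c, π⁻¹ s = c → ∃ a, Fin.castAddEmb r a = c := by
        intro c
        refine Fin.addCases (fun a _ => ⟨a, rfl⟩) (fun i hi => ?_) c
        have := h i
        rw [← hi, Equiv.Perm.coe_inv, Equiv.apply_symm_apply] at this
        exact absurd hs this
      exact this _ rfl
    · intro h i hi
      obtain ⟨a, ha⟩ := h _ hi
      rw [Equiv.Perm.coe_inv, Equiv.symm_apply_apply] at ha
      have := congrArg Fin.val ha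
      simp at this
      omega
  have hS : S.card ≤ n + r := by simpa using S.card_le_univ
  have h3 : ((n + r).descFactorial S.card : ℝ) ≠ 0 := by
    have := Nat.descFactorial_pos.mpr hS
    positivity
  rw [h2, headProb, mul_div_assoc', eq_div_iff h3]
  have h4 := congrArg (Nat.cast : ℕ → ℝ) h1
  push_cast at h4
  convert! h4

/-! ### Matrix elements of the lifted blurring map -/

/-- The sum over pairs of strings of types `h` and `k` of the probability that their joint support,
with `u` further points, is sent to the first `n` positions. -/
def pairProb {m : ℕ} (n r u : ℕ) (h k : Fin m → ℕ) : ℝ :=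
  ∑ p ∈ typeClass n (fullType n h) ×ˢ typeClass n (fullType n k),
    headProb n r ((Finset.univ.filter fun i => p.1 i ≠ 0 ∨ p.2 i ≠ 0).card + u)

/-- Expand the product of counts into pairs (x, y). A pair counts for π exactly when π sends the
tail off the joint support of (x, z) and (y, z), whose size is |supp x ∪ supp y| + |supp z|. -/
theorem sum_mixCount_mul {m n r : ℕ} (z : Fin r → Fin (m + 1)) (h k : Fin m → ℕ) :
    ∑ π : Equiv.Perm (Fin (n + r)), (mixCount (π, z) h * mixCount (π, z) k : ℝ) =
      (n + r).factorial * pairProb n r (∑ i, Fin.tail (typeOf z) i) h k := by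
  have h1 : ∀ π : Equiv.Perm (Fin (n + r)), (mixCount (π, z) h * mixCount (π, z) k : ℝ) =
      ∑ p ∈ typeClass n (fullType n h) ×ˢ typeClass n (fullType n k),
        if ZeroTail π p.1 z ∧ ZeroTail π p.2 z then (1 : ℝ) else 0 := by
    intro π
    simp only [mixCount, Finset.card_filter, Nat.cast_sum, Nat.cast_ite, Nat.cast_one,
      Nat.cast_zero]
    rw [Finset.sum_mul_sum, ← Finset.sum_product']
    refine Finset.sum_congr rfl fun p _ => ?_
    by_cases ha : ZeroTail π p.1 z <;> by_cases hb : ZeroTail π p.2 z <;> simp [ha, hb]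
  rw [Finset.sum_congr rfl fun π _ => h1 π, Finset.sum_comm, pairProb, Finset.mul_sum]
  refine Finset.sum_congr rfl fun p _ => ?_
  set S : Finset (Fin (n + r)) :=
    Finset.univ.filter fun c => Fin.append p.1 z c ≠ 0 ∨ Fin.append p.2 z c ≠ 0 with hS
  have hcard : S.card = (Finset.univ.filter fun i => p.1 i ≠ 0 ∨ p.2 i ≠ 0).card +
      ∑ i, Fin.tail (typeOf z) i := by
    rw [← card_support, hS]
    simp only [Finset.card_filter, Fin.sum_univ_add, Fin.append_left, Fin.append_right, or_self]
  rw [← hcard, ← card_perm_avoid, Finset.sum_boole]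
  congr 2
  refine Finset.filter_congr fun π _ => ?_
  simp only [ZeroTail, hS, Finset.mem_filter, Finset.mem_univ, true_and, not_or, not_not,
    forall_and]

/-- Pairs with disjoint supports contribute the stated value exactly; each other pair errs by at
most 1, a difference of two probabilities. -/
theorem abs_pairProb_sub_le {m : ℕ} (n r u : ℕ) (h k : Fin m → ℕ) :
    |pairProb n r u h k - (typeClass n (fullType n h)).card * (typeClass n (fullType n k)).card *
      headProb n r (∑ i, h i + ∑ i, k i + u)| ≤ (meetingPairs n h k).card := by
  have h1 : ((typeClass n (fullType n h)).card * (typeClass n (fullType n k)).card : ℝ) *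
      headProb n r (∑ i, h i + ∑ i, k i + u) =
      ∑ p ∈ typeClass n (fullType n h) ×ˢ typeClass n (fullType n k),
        headProb n r (∑ i, h i + ∑ i, k i + u) := by
    rw [Finset.sum_const, Finset.card_product, nsmul_eq_mul, Nat.cast_mul]
  rw [h1, pairProb, ← Finset.sum_sub_distrib, meetingPairs, Finset.card_filter, Nat.cast_sum]
  refine (Finset.abs_sum_le_sum_abs _ _).trans (Finset.sum_le_sum fun p hp => ?_)
  rw [Finset.mem_product] at hp
  split_ifs with hm
  · rw [abs_le]
    have hle := headProb_le_one n r
    push_cast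
    constructor <;> linarith [hle (∑ i, h i + ∑ i, k i + u), headProb_nonneg n r
      (∑ i, h i + ∑ i, k i + u), headProb_nonneg n r
      ((Finset.univ.filter fun i => p.1 i ≠ 0 ∨ p.2 i ≠ 0).card + u), hle
      ((Finset.univ.filter fun i => p.1 i ≠ 0 ∨ p.2 i ≠ 0).card + u)]
  · have hd : Disjoint (Finset.univ.filter fun i => p.1 i ≠ 0)
        (Finset.univ.filter fun i => p.2 i ≠ 0) := by
      rw [Finset.disjoint_filter]
      exact fun i _ h1 h2 => hm ⟨i, h1, h2⟩
    rw [Finset.filter_or, Finset.card_union_of_disjoint hd, card_support_of_mem hp.1,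
      card_support_of_mem hp.2]
    simp

theorem inner_kraus_mixOp {m n r : ℕ} (h k s t : Fin m → ℕ) :
    ⟪ket h, kraus (mixOp (m := m) (n := n) (r := r)) (ketBra (ket s) (ket t)) (ket k)⟫_ℂ =
      ∑ p : Equiv.Perm (Fin (n + r)) × (Fin r → Fin (m + 1)),
        ⟪ket h, mixOp p (ket s)⟫_ℂ * star ⟪ket k, mixOp p (ket t)⟫_ℂ := by
  refine (isKraus_mixOp.hasSum_inner (isTraceClass_ketBra _ _) (ket h) (ket k)).unique ?_
  refine (hasSum_fintype fun p : Equiv.Perm (Fin (n + r)) × (Fin r → Fin (m + 1)) =>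
    ⟪ket h, mixOp p (ket s)⟫_ℂ * star ⟪ket k, mixOp p (ket t)⟫_ℂ).congr_fun fun p => ?_
  rw [inner_ketBra, ContinuousLinearMap.adjoint_inner_left, ContinuousLinearMap.adjoint_inner_right,
    ← inner_conj_symm (mixOp p (ket t)) (ket k)]
  rfl

theorem inner_mixOp_ket_eq_zero {m n r : ℕ}
    (p : Equiv.Perm (Fin (n + r)) × (Fin r → Fin (m + 1))) {h s : Fin m → ℕ} (hs : ∑ i, s i ≤ n)
    (hne : h + Fin.tail (typeOf p.2) ≠ s) : ⟪ket h, mixOp p (ket s)⟫_ℂ = 0 := by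
  by_cases hh : ∑ i, h i ≤ n
  · rw [inner_mixOp_ket p hh hs, if_neg hne]
    simp
  · rw [inner_mixOp, embeddingAdj_ket, if_neg hh]
    simp

theorem inner_kraus_mixOp_eq_zero {m n r : ℕ} {h k s t : Fin m → ℕ} (hs : ∑ i, s i ≤ n)
    (ht : ∑ i, t i ≤ n) (hne : ∀ j, ¬ (h + j = s ∧ k + j = t)) :
    ⟪ket h, kraus (mixOp (m := m) (n := n) (r := r)) (ketBra (ket s) (ket t)) (ket k)⟫_ℂ = 0 := by
  rw [inner_kraus_mixOp]
  refine Finset.sum_eq_zero fun p _ => ?_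
  rcases not_and_or.mp (hne (Fin.tail (typeOf p.2))) with h1 | h1
  · rw [inner_mixOp_ket_eq_zero p hs h1, zero_mul]
  · rw [inner_mixOp_ket_eq_zero p ht h1, star_zero, mul_zero]

/-- Only strings z with nonzero symbols counted by j survive. For each of them the sum over π is the
same, and its factor (n+r)! cancels the normalisation of the Kraus operators. -/
theorem inner_kraus_mixOp_eq {m n r : ℕ} {h k j : Fin m → ℕ} (hs : ∑ i, (h + j) i ≤ n)
    (ht : ∑ i, (k + j) i ≤ n) :
    ⟪ket h, kraus (mixOp (m := m) (n := n) (r := r)) (ketBra (ket (h + j)) (ket (k + j)))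
      (ket k)⟫_ℂ =
    (((Real.sqrt (typeClass n (fullType n h)).card)⁻¹ *
      (Real.sqrt (typeClass n (fullType n (h + j))).card)⁻¹ *
      ((Real.sqrt (typeClass n (fullType n k)).card)⁻¹ *
      (Real.sqrt (typeClass n (fullType n (k + j))).card)⁻¹) *
      ((Finset.univ.filter fun z : Fin r → Fin (m + 1) => Fin.tail (typeOf z) = j).card *
        pairProb n r (∑ i, j i) h k) : ℝ) : ℂ) := by
  have hh : ∑ i, h i ≤ n := le_trans (Finset.sum_le_sum fun i _ => by simp) hs
  have hk : ∑ i, k i ≤ n := le_trans (Finset.sum_le_sum fun i _ => by simp) ht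
  rw [inner_kraus_mixOp]
  simp only [inner_mixOp_ket _ hh hs, inner_mixOp_ket _ hk ht, add_right_inj]
  set c := (Real.sqrt (typeClass n (fullType n h)).card)⁻¹ *
      (Real.sqrt (typeClass n (fullType n (h + j))).card)⁻¹
  set c' := (Real.sqrt (typeClass n (fullType n k)).card)⁻¹ *
      (Real.sqrt (typeClass n (fullType n (k + j))).card)⁻¹
  have hstar : ∀ a : ℝ, star (a : ℂ) = a := Complex.conj_ofReal
  simp only [hstar, ← Complex.ofReal_mul, ← Complex.ofReal_sum]
  congr 1
  rw [Fintype.sum_prod_type, Finset.sum_comm]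
  have hN : ((n + r).factorial : ℝ) ≠ 0 := by positivity
  have h1 : ∀ z : Fin r → Fin (m + 1), ∑ π : Equiv.Perm (Fin (n + r)),
      ((Real.sqrt (n + r).factorial)⁻¹ *
        (c * if Fin.tail (typeOf z) = j then (mixCount (π, z) h : ℝ) else 0)) *
      ((Real.sqrt (n + r).factorial)⁻¹ *
        (c' * if Fin.tail (typeOf z) = j then (mixCount (π, z) k : ℝ) else 0)) =
      if Fin.tail (typeOf z) = j then c * c' * pairProb n r (∑ i, j i) h k else 0 := by
    intro z
    split_ifs with hz
    · have h2 : ∀ π : Equiv.Perm (Fin (n + r)),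
          ((Real.sqrt (n + r).factorial)⁻¹ * (c * (mixCount (π, z) h : ℝ))) *
          ((Real.sqrt (n + r).factorial)⁻¹ * (c' * (mixCount (π, z) k : ℝ))) =
          ((n + r).factorial : ℝ)⁻¹ * (c * c') * (mixCount (π, z) h * mixCount (π, z) k) := by
        intro π
        rw [show (((n + r).factorial : ℝ)⁻¹) = (Real.sqrt (n + r).factorial)⁻¹ *
          (Real.sqrt (n + r).factorial)⁻¹ by
            rw [← mul_inv, Real.mul_self_sqrt (by positivity)]]
        ring
      rw [Finset.sum_congr rfl fun π _ => h2 π, ← Finset.mul_sum, sum_mixCount_mul, hz]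
      field_simp
    · simp
  rw [Finset.sum_congr rfl fun z _ => h1 z, ← Finset.sum_filter, Finset.sum_const, nsmul_eq_mul]
  ring

/-! ### Asymptotics of the matrix elements -/

theorem tendsto_descFactorial_div_pow {f : ℕ → ℕ} {c : ℝ}
    (hf : Tendsto (fun n => (f n : ℝ) / n) atTop (𝓝 c)) (k : ℕ) :
    Tendsto (fun n => ((f n).descFactorial k : ℝ) / (n : ℝ) ^ k) atTop (𝓝 (c ^ k)) := by
  induction k with
  | zero => simp
  | succ k ih =>
    -- The truncated difference lies between the real numbers f n - k and f n.
    have h1 : Tendsto (fun n => ((f n - k : ℕ) : ℝ) / n) atTop (𝓝 c) := by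
      have h0 : Tendsto (fun n : ℕ => (f n : ℝ) / n - (k : ℝ) / n) atTop (𝓝 c) := by
        simpa using hf.sub (tendsto_const_div_atTop_nhds_zero_nat (k : ℝ))
      refine tendsto_of_tendsto_of_tendsto_of_le_of_le h0 hf (fun n => ?_) fun n => ?_
      · simp only
        rw [← sub_div]
        gcongr
        rw [sub_le_iff_le_add]
        exact_mod_cast (by omega : f n ≤ f n - k + k)
      · simp only
        gcongr
        exact Nat.sub_le _ _
    have h2 := h1.mul ih
    rw [← pow_succ'] at h2
    refine h2.congr fun n => ?_
    rw [Nat.descFactorial_succ, pow_succ', Nat.cast_mul, mul_div_mul_comm]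

theorem tendsto_natCast_div_self : Tendsto (fun n : ℕ => (n : ℝ) / n) atTop (𝓝 1) :=
  tendsto_const_nhds.congr' ((eventually_ne_atTop 0).mono fun n hn =>
    (div_self (by exact_mod_cast hn)).symm)

theorem tendsto_floor_div {δ : ℝ} (hδ : 0 ≤ δ) :
    Tendsto (fun n : ℕ => (⌊δ * n⌋₊ : ℝ) / n) atTop (𝓝 δ) :=
  (tendsto_nat_floor_mul_div_atTop hδ).comp tendsto_natCast_atTop_atTop

theorem tendsto_headProb {δ : ℝ} (hδ : 0 ≤ δ) (u : ℕ) :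
    Tendsto (fun n : ℕ => headProb n ⌊δ * n⌋₊ u) atTop (𝓝 ((1 / (1 + δ)) ^ u)) := by
  have h1 := tendsto_descFactorial_div_pow tendsto_natCast_div_self u
  have h2 := tendsto_descFactorial_div_pow (f := fun n => n + ⌊δ * n⌋₊) (c := 1 + δ) (by
    simpa [add_div] using tendsto_natCast_div_self.add (tendsto_floor_div hδ)) u
  have h3 := h1.div h2 (by positivity)
  rw [← div_pow] at h3
  refine h3.congr' ((eventually_ne_atTop 0).mono fun n hn => ?_)
  have : (n : ℝ) ^ u ≠ 0 := pow_ne_zero _ (by exact_mod_cast hn)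
  simp only [Pi.div_apply, headProb]
  rw [div_div_div_cancel_right₀ this]

theorem typeClass_card_eq {m n : ℕ} {h : Fin m → ℕ} (hn : ∑ i, h i ≤ n) :
    ((typeClass n (fullType n h)).card : ℝ) =
      n.descFactorial (∑ i, h i) / ∏ i, ((h i).factorial : ℝ) := by
  rw [eq_div_iff (by positivity)]
  exact_mod_cast card_typeClass_fullType hn

theorem typeClass_card_pos {m n : ℕ} {h : Fin m → ℕ} (hn : ∑ i, h i ≤ n) :
    (0 : ℝ) < (typeClass n (fullType n h)).card := by
  rw [typeClass_card_eq hn]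
  have := Nat.descFactorial_pos.mpr hn
  positivity

theorem tendsto_typeClass_card {m : ℕ} (h : Fin m → ℕ) :
    Tendsto (fun n : ℕ => ((typeClass n (fullType n h)).card : ℝ) / (n : ℝ) ^ ∑ i, h i) atTop
      (𝓝 (1 / ∏ i, ((h i).factorial : ℝ))) := by
  have h1 := (tendsto_descFactorial_div_pow tendsto_natCast_div_self (∑ i, h i)).div_const
    (∏ i, ((h i).factorial : ℝ))
  rw [one_pow] at h1
  refine h1.congr' ((eventually_ge_atTop (∑ i, h i)).mono fun n hn => ?_)
  simp only [typeClass_card_eq hn]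
  rw [div_right_comm]

theorem tendsto_tail_typeOf_card {m : ℕ} {δ : ℝ} (hδ : 0 ≤ δ) (j : Fin m → ℕ) :
    Tendsto (fun n : ℕ => ((Finset.univ.filter fun z : Fin ⌊δ * n⌋₊ → Fin (m + 1) =>
      Fin.tail (typeOf z) = j).card : ℝ) / (n : ℝ) ^ ∑ i, j i) atTop
      (𝓝 (δ ^ (∑ i, j i) / ∏ i, ((j i).factorial : ℝ))) := by
  have h1 := (tendsto_descFactorial_div_pow (tendsto_floor_div hδ) (∑ i, j i)).div_const
    (∏ i, ((j i).factorial : ℝ))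
  refine h1.congr fun n => ?_
  have h2 := card_tail_typeOf ⌊δ * n⌋₊ j
  rw [div_right_comm, ← h2]
  push_cast
  rw [mul_div_cancel_right₀ _ (by positivity)]

/-- After normalisation the meeting pairs cost at most |h||k|/n, so only the limit of `headProb` for
disjoint supports remains. -/
theorem tendsto_pairProb_div {m : ℕ} {δ : ℝ} (hδ : 0 ≤ δ) (u : ℕ) (h k : Fin m → ℕ) :
    Tendsto (fun n : ℕ => pairProb n ⌊δ * n⌋₊ u h k /
      ((typeClass n (fullType n h)).card * (typeClass n (fullType n k)).card)) atTop
      (𝓝 ((1 / (1 + δ)) ^ (∑ i, h i + ∑ i, k i + u))) := by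
  have h1 := tendsto_headProb hδ (∑ i, h i + ∑ i, k i + u)
  have h2 : Tendsto (fun n : ℕ => (((∑ i, h i : ℕ) * (∑ i, k i : ℕ) : ℝ)) / n) atTop (𝓝 0) :=
    tendsto_const_div_atTop_nhds_zero_nat _
  rw [← sub_zero ((1 / (1 + δ)) ^ (∑ i, h i + ∑ i, k i + u))]
  have h3 : Tendsto (fun n : ℕ => pairProb n ⌊δ * n⌋₊ u h k /
      ((typeClass n (fullType n h)).card * (typeClass n (fullType n k)).card) -
      headProb n ⌊δ * n⌋₊ (∑ i, h i + ∑ i, k i + u)) atTop (𝓝 0) := by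
    refine squeeze_zero_norm' ?_ h2
    filter_upwards [eventually_ge_atTop (∑ i, h i), eventually_ge_atTop (∑ i, k i),
      eventually_gt_atTop 0] with n hh hk hn
    have hT := mul_pos (typeClass_card_pos hh) (typeClass_card_pos hk)
    have hn' : (0 : ℝ) < n := by exact_mod_cast hn
    rw [Real.norm_eq_abs, div_sub' hT.ne', abs_div, abs_of_pos hT, div_le_div_iff₀ hT hn']
    refine (mul_le_mul_of_nonneg_right (abs_pairProb_sub_le n _ u h k) hn'.le).trans ?_
    exact_mod_cast card_meetingPairs_mul_le n h k
  simpa using h3.add h1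

theorem lossWeight_mul_lossWeight {δ : ℝ} (hδ : 0 < δ) (j h k : ℕ) :
    lossWeight ((1 / (1 + δ)) ^ 2) (δ / (1 + δ)) j h *
      lossWeight ((1 / (1 + δ)) ^ 2) (δ / (1 + δ)) j k =
    Real.sqrt (((h + j).factorial * (k + j).factorial : ℝ) / (h.factorial * k.factorial)) *
      (δ ^ j / j.factorial * (1 / (1 + δ)) ^ (h + k + j)) := by
  rw [lossWeight, lossWeight, ← Real.sqrt_mul (by positivity)]
  rw [← Real.sqrt_sq (by positivity : 0 ≤ δ ^ j / j.factorial * (1 / (1 + δ)) ^ (h + k + j)),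
    ← Real.sqrt_mul (by positivity)]
  congr 1
  have hc : ∀ a : ℕ, ((a + j).choose j : ℝ) = (a + j).factorial / (a.factorial * j.factorial) := by
    intro a
    rw [eq_div_iff (by positivity), ← mul_assoc]
    have := Nat.add_choose_mul_factorial_mul_factorial a j
    exact_mod_cast this
  rw [hc, hc, div_eq_mul_one_div δ]
  generalize 1 / (1 + δ) = q
  field_simp
  ring

theorem prod_lossWeight_mul {m : ℕ} {δ : ℝ} (hδ : 0 < δ) (h k j : Fin m → ℕ) :
    (∏ i, lossWeight ((1 / (1 + δ)) ^ 2) (δ / (1 + δ)) (j i) (h i)) *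
        ∏ i, lossWeight ((1 / (1 + δ)) ^ 2) (δ / (1 + δ)) (j i) (k i) =
      Real.sqrt ((1 / ∏ i, ((h i).factorial : ℝ)) / (1 / ∏ i, (((h + j) i).factorial : ℝ))) *
      Real.sqrt ((1 / ∏ i, ((k i).factorial : ℝ)) / (1 / ∏ i, (((k + j) i).factorial : ℝ))) *
      (δ ^ (∑ i, j i) / (∏ i, ((j i).factorial : ℝ)) *
        (1 / (1 + δ)) ^ (∑ i, h i + ∑ i, k i + ∑ i, j i)) := by
  have hF : ∀ g : Fin m → ℕ, (0 : ℝ) < ∏ i, ((g i).factorial : ℝ) := fun g => by positivity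
  rw [← Finset.prod_mul_distrib, Finset.prod_congr rfl fun i _ =>
    lossWeight_mul_lossWeight hδ (j i) (h i) (k i), Finset.prod_mul_distrib,
    ← Real.sqrt_prod _ fun i _ => by positivity, Finset.prod_mul_distrib,
    Finset.prod_div_distrib, Finset.prod_div_distrib, Finset.prod_pow_eq_pow_sum,
    Finset.prod_pow_eq_pow_sum,
    ← Real.sqrt_mul (by have := hF h; have := hF (h + j); positivity),
    Finset.sum_add_distrib, Finset.sum_add_distrib]
  congr 2
  rw [Finset.prod_mul_distrib, Finset.prod_mul_distrib]
  have := hF h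
  have := hF k
  simp only [Pi.add_apply]
  field_simp

theorem sqrt_ratio_eq {a b x y : ℝ} (ha : 0 < a) (hb : 0 < b) (hx : 0 < x) (hy : 0 < y) :
    Real.sqrt ((a / x) / (b / (x * y))) =
      a * ((Real.sqrt a)⁻¹ * (Real.sqrt b)⁻¹) * Real.sqrt y := by
  rw [Real.sqrt_eq_iff_mul_self_eq (by positivity) (by positivity)]
  have e : ∀ a b c d : ℝ, a * (b * c) * d * (a * (b * c) * d) =
    a ^ 2 * ((b * b) * (c * c)) * (d * d) := fun a b c d => by ring
  rw [e, ← mul_inv, ← mul_inv, Real.mul_self_sqrt ha.le, Real.mul_self_sqrt hb.le,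
    Real.mul_self_sqrt hy.le]
  field_simp

/-- Applied with type class sizes a, a', b, b' (of h, k, h+j, k+j), xa = n^|h|, xb = n^|k|, y =
n^|j|, x the number of strings z and z the pair sum. The powers of n cancel, so the exact entry is a
product of factors with known limits. -/
theorem ratio_combine {a a' b b' x y z : ℝ} (ha : 0 < a) (ha' : 0 < a') (hb : 0 < b) (hb' : 0 < b')
    {xa xb : ℝ} (hxa : 0 < xa) (hxb : 0 < xb) (hy : 0 < y) :
    Real.sqrt ((a / xa) / (b / (xa * y))) * Real.sqrt ((a' / xb) / (b' / (xb * y))) *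
      (x / y * (z / (a * a'))) =
    (Real.sqrt a)⁻¹ * (Real.sqrt b)⁻¹ * ((Real.sqrt a')⁻¹ * (Real.sqrt b')⁻¹) * (x * z) := by
  rw [sqrt_ratio_eq ha hb hxa hy, sqrt_ratio_eq ha' hb' hxb hy]
  have e : y = Real.sqrt y * Real.sqrt y := (Real.mul_self_sqrt hy.le).symm
  have hw : 0 < Real.sqrt y := Real.sqrt_pos.mpr hy
  rw [show x / y = x / (Real.sqrt y * Real.sqrt y) by rw [← e]]
  generalize Real.sqrt y = w at hw
  generalize (Real.sqrt a)⁻¹ = p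
  generalize (Real.sqrt a')⁻¹ = q
  generalize (Real.sqrt b)⁻¹ = p'
  generalize (Real.sqrt b')⁻¹ = q'
  field_simp

theorem tendsto_inner_kraus_mixOp {m : ℕ} {δ : ℝ} (hδ : 0 < δ) (h k j : Fin m → ℕ) :
    Tendsto (fun n : ℕ => ⟪ket h, kraus (mixOp (m := m) (n := n) (r := ⌊δ * n⌋₊))
      (ketBra (ket (h + j)) (ket (k + j))) (ket k)⟫_ℂ) atTop
      (𝓝 (((∏ i, lossWeight ((1 / (1 + δ)) ^ 2) (δ / (1 + δ)) (j i) (h i)) *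
        ∏ i, lossWeight ((1 / (1 + δ)) ^ 2) (δ / (1 + δ)) (j i) (k i) : ℝ) : ℂ)) := by
  have hF : ∀ g : Fin m → ℕ, (0 : ℝ) < ∏ i, ((g i).factorial : ℝ) := fun g => by positivity
  have hsum : ∀ g : Fin m → ℕ, ∑ i, (g + j) i = ∑ i, g i + ∑ i, j i := fun g => by
    simp [Finset.sum_add_distrib]
  have hq : ∀ g : Fin m → ℕ, Tendsto (fun n : ℕ =>
      Real.sqrt ((((typeClass n (fullType n g)).card : ℝ) / (n : ℝ) ^ ∑ i, g i) /
        (((typeClass n (fullType n (g + j))).card : ℝ) / (n : ℝ) ^ ∑ i, (g + j) i))) atTop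
      (𝓝 (Real.sqrt ((1 / ∏ i, ((g i).factorial : ℝ)) /
        (1 / ∏ i, (((g + j) i).factorial : ℝ))))) := fun g =>
    (Real.continuous_sqrt.tendsto _).comp ((tendsto_typeClass_card g).div
      (tendsto_typeClass_card (g + j)) (by have := hF (g + j); positivity))
  have hlim := ((hq h).mul (hq k)).mul ((tendsto_tail_typeOf_card hδ.le j).mul
    (tendsto_pairProb_div hδ.le (∑ i, j i) h k))
  rw [prod_lossWeight_mul hδ]
  refine ((Complex.continuous_ofReal.tendsto _).comp hlim).congr' ?_
  filter_upwards [eventually_ge_atTop (∑ i, (h + j) i), eventually_ge_atTop (∑ i, (k + j) i),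
      eventually_gt_atTop 0] with n hh hk hn
  have hn' : (0 : ℝ) < n := by exact_mod_cast hn
  rw [Function.comp_apply, inner_kraus_mixOp_eq hh hk]
  refine congrArg _ ?_
  have hh' : ∑ i, h i ≤ n := by rw [hsum] at hh; omega
  have hk' : ∑ i, k i ≤ n := by rw [hsum] at hk; omega
  simp only [hsum, pow_add]
  exact ratio_combine (typeClass_card_pos hh') (typeClass_card_pos hk') (typeClass_card_pos hh)
    (typeClass_card_pos hk) (by positivity) (by positivity) (by positivity)

/-! ### Convergence on the matrix units -/

/-- Y is then a finite combination of matrix units, each of trace norm at most 1. -/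
theorem traceNorm_le_sum_of_support {ι : Type} [DecidableEq ι] (Y : Op ι) (F G : Finset ι)
    (h0 : ∀ h k, ⟪ket h, Y (ket k)⟫_ℂ ≠ 0 → h ∈ F ∧ k ∈ G) :
    traceNorm Y ≤ ∑ p ∈ F ×ˢ G, ‖⟪ket p.1, Y (ket p.2)⟫_ℂ‖ₑ := by
  have hY : Y = ∑ p ∈ F ×ˢ G, ⟪ket p.1, Y (ket p.2)⟫_ℂ • ketBra (ket p.1) (ket p.2) := by
    refine Op.ext_ket fun h k => ?_
    simp only [sum_apply, smul_apply, inner_sum, inner_smul_right,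
      inner_ketBra, inner_ket_ket]
    by_cases hz : ⟪ket h, Y (ket k)⟫_ℂ = 0
    · rw [hz]
      refine (Finset.sum_eq_zero fun p _ => ?_).symm
      by_cases h1 : h = p.1 <;> by_cases h2 : p.2 = k
      · rw [← h1, h2, hz, zero_mul]
      all_goals simp [h1, h2]
    · rw [Finset.sum_eq_single_of_mem (h, k) (Finset.mem_product.mpr (h0 h k hz))]
      · simp
      · rintro ⟨h', k'⟩ - hne
        by_cases h1 : h = h' <;> by_cases h2 : k' = k
        · exact absurd (by rw [h1, h2]) hne
        all_goals simp [h1, h2]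
  conv_lhs => rw [hY]
  refine (traceNorm_sum_le _ _).trans (Finset.sum_le_sum fun p _ => ?_)
  refine (traceNorm_smul_le _ _).trans ?_
  refine le_trans (mul_le_mul' le_rfl (traceNorm_ketBra_le _ _)) ?_
  simp [← ofReal_norm, norm_ket]

theorem inner_shift_ketBra {ι : Type} [DecidableEq ι] [Add ι] [IsCancelAdd ι]
    {w : ι → ι → ℝ} (hw : IsLossWeight w) (h k j : ι) :
    ⟪ket h, kraus (shiftOp w) (ketBra (ket (h + j)) (ket (k + j))) (ket k)⟫_ℂ =
      ((w j h * w j k : ℝ) : ℂ) := by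
  refine (hw.hasSum_inner (isTraceClass_ketBra _ _) h k).unique ?_
  convert! hasSum_ite_eq j ((w j h * w j k : ℝ) : ℂ) using 2 with j'
  rw [inner_ketBra, inner_ket_ket, inner_ket_ket]
  by_cases hj : j' = j
  · simp [hj]
  · simp [hj]

theorem inner_shift_ketBra_eq_zero {ι : Type} [DecidableEq ι] [Add ι] [IsCancelAdd ι]
    {w : ι → ι → ℝ} (hw : IsLossWeight w) {h k s t : ι} (hne : ∀ j, ¬ (h + j = s ∧ k + j = t)) :
    ⟪ket h, kraus (shiftOp w) (ketBra (ket s) (ket t)) (ket k)⟫_ℂ = 0 := by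
  refine (hw.hasSum_inner (isTraceClass_ketBra _ _) h k).unique ?_
  convert! hasSum_zero using 2 with j
  rw [inner_ketBra, inner_ket_ket, inner_ket_ket]
  rcases not_and_or.mp (hne j) with h1 | h1
  · simp [h1]
  · simp [Ne.symm h1]

theorem tendsto_traceNorm_ketBra_ket {m : ℕ} {δ : ℝ} (hδ : 0 < δ)
    (hw : IsLossWeight fun j h : Fin m → ℕ =>
      ∏ i, lossWeight ((1 / (1 + δ)) ^ 2) (δ / (1 + δ)) (j i) (h i)) (s t : Fin m → ℕ) :
    Tendsto (fun n : ℕ => traceNorm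
      (kraus (mixOp (m := m) (n := n) (r := ⌊δ * n⌋₊)) (ketBra (ket s) (ket t)) -
        kraus (shiftOp fun j h : Fin m → ℕ =>
          ∏ i, lossWeight ((1 / (1 + δ)) ^ 2) (δ / (1 + δ)) (j i) (h i))
          (ketBra (ket s) (ket t)))) atTop (𝓝 0) := by
  set Y : ℕ → Op (Fin m → ℕ) := fun n =>
    kraus (mixOp (m := m) (n := n) (r := ⌊δ * n⌋₊)) (ketBra (ket s) (ket t)) -
      kraus (shiftOp fun j h : Fin m → ℕ =>
        ∏ i, lossWeight ((1 / (1 + δ)) ^ 2) (δ / (1 + δ)) (j i) (h i)) (ketBra (ket s) (ket t))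
    with hY
  have hzero : ∀ n, ∑ i, s i ≤ n → ∑ i, t i ≤ n → ∀ h k,
      (∀ j, ¬ (h + j = s ∧ k + j = t)) → ⟪ket h, Y n (ket k)⟫_ℂ = 0 := by
    intro n hs ht h k hne
    rw [hY]
    simp only [sub_apply, inner_sub_right]
    rw [inner_kraus_mixOp_eq_zero hs ht hne, inner_shift_ketBra_eq_zero hw hne, sub_zero]
  have hentry : ∀ h k, Tendsto (fun n => ⟪ket h, Y n (ket k)⟫_ℂ) atTop (𝓝 0) := by
    intro h k
    by_cases hex : ∃ j, h + j = s ∧ k + j = t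
    · obtain ⟨j, rfl, rfl⟩ := hex
      have h1 := (tendsto_inner_kraus_mixOp hδ h k j).sub_const
        ⟪ket h, kraus (shiftOp fun j h : Fin m → ℕ =>
          ∏ i, lossWeight ((1 / (1 + δ)) ^ 2) (δ / (1 + δ)) (j i) (h i))
          (ketBra (ket (h + j)) (ket (k + j))) (ket k)⟫_ℂ
      rw [inner_shift_ketBra hw, sub_self] at h1
      refine h1.congr fun n => ?_
      rw [hY, ← inner_shift_ketBra hw, ← inner_sub_right]
      rfl
    · refine tendsto_const_nhds.congr' ?_
      filter_upwards [eventually_ge_atTop (∑ i, s i), eventually_ge_atTop (∑ i, t i)] with n hs ht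
      exact (hzero n hs ht h k fun j hj => hex ⟨j, hj⟩).symm
  have hsum : Tendsto (fun n => ∑ p ∈ Finset.Iic s ×ˢ Finset.Iic t,
      ‖⟪ket p.1, Y n (ket p.2)⟫_ℂ‖ₑ) atTop (𝓝 0) := by
    rw [← Finset.sum_const_zero (s := Finset.Iic s ×ˢ Finset.Iic t)]
    refine tendsto_finsetSum _ fun p _ => ?_
    simpa using (hentry p.1 p.2).enorm
  refine tendsto_of_tendsto_of_tendsto_of_le_of_le' tendsto_const_nhds hsum
    (Eventually.of_forall fun n => zero_le) ?_
  filter_upwards [eventually_ge_atTop (∑ i, s i), eventually_ge_atTop (∑ i, t i)] with n hs ht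
  -- The selection rule forces h ≤ s and k ≤ t, so a finite box independent of n carries all
  -- entries.
  refine traceNorm_le_sum_of_support (Y n) _ _ fun h k hne => ?_
  by_contra hmem
  refine hne (hzero n hs ht h k fun j hj => hmem ?_)
  rw [Finset.mem_Iic, Finset.mem_Iic, ← hj.1, ← hj.2]
  exact ⟨le_self_add, le_self_add⟩

/-! ### From matrix units to trace class operators -/

theorem ketBra_add_left {ι : Type} (u u' v : Hilb ι) :
    ketBra (u + u') v = ketBra u v + ketBra u' v := by simp [ketBra]

theorem ketBra_add_right {ι : Type} (u v v' : Hilb ι) :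
    ketBra u (v + v') = ketBra u v + ketBra u v' := by simp [ketBra]

theorem ketBra_smul_left {ι : Type} (c : ℂ) (u v : Hilb ι) :
    ketBra (c • u) v = c • ketBra u v := by simp [ketBra]

theorem ketBra_smul_right {ι : Type} (c : ℂ) (u v : Hilb ι) :
    ketBra u (c • v) = star c • ketBra u v := by simp [ketBra]

/-- A set of trace class operators which is closed in trace norm, closed under linear combinations,
and contains the matrix units, contains all trace class operators. -/
theorem traceClass_induction {ι : Type} [DecidableEq ι] {P : Op ι → Prop}
    (hzero : P 0) (hket : ∀ s t : ι, P (ketBra (ket s) (ket t)))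
    (hadd : ∀ X Y, IsTraceClass X → IsTraceClass Y → P X → P Y → P (X + Y))
    (hsmul : ∀ (c : ℂ) X, IsTraceClass X → P X → P (c • X))
    (hlim : ∀ X, IsTraceClass X →
      (∀ ε : ℝ≥0∞, 0 < ε → ∃ Y, IsTraceClass Y ∧ P Y ∧ traceNorm (X - Y) ≤ ε) → P X)
    (X : Op ι) (hX : IsTraceClass X) : P X := by
  have hdense : ∀ (u : Hilb ι) (ε : ℝ), 0 < ε →
      ∃ u' ∈ Submodule.span ℂ (Set.range (ket : ι → Hilb ι)), ‖u - u'‖ < ε := by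
    intro u ε hε
    have hd := (ketBasis ι).dense_span
    rw [show (⇑(ketBasis ι) : ι → Hilb ι) = ket from funext ketBasis_apply] at hd
    have hu : u ∈ closure (Submodule.span ℂ (Set.range (ket : ι → Hilb ι)) : Set (Hilb ι)) := by
      rw [← Submodule.topologicalClosure_coe, hd]
      exact Submodule.mem_top
    obtain ⟨u', hu', hlt⟩ := Metric.mem_closure_iff.mp hu ε hε
    exact ⟨u', hu', by rwa [dist_eq_norm] at hlt⟩
  have hsmall : ∀ (v : Hilb ι) (ε : ℝ≥0∞), 0 < ε →
      ∃ η : ℝ, 0 < η ∧ ENNReal.ofReal η * ‖v‖ₑ ≤ ε := by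
    intro v ε hε
    rcases eq_or_ne ε ∞ with rfl | hε'
    · exact ⟨1, one_pos, le_top⟩
    have he : 0 < ε.toReal := ENNReal.toReal_pos hε.ne' hε'
    -- The added 1 covers v = 0.
    refine ⟨ε.toReal / (‖v‖ + 1), by positivity, ?_⟩
    rw [← ofReal_norm, ← ENNReal.ofReal_mul (by positivity)]
    refine ENNReal.ofReal_le_of_le_toReal ?_
    rw [div_mul_eq_mul_div, div_le_iff₀ (by positivity)]
    nlinarith [norm_nonneg v]
  have hleft : ∀ v : Hilb ι, (∀ s, P (ketBra (ket s) v)) → ∀ u, P (ketBra u v) := by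
    intro v hv u
    have hspan : ∀ u' ∈ Submodule.span ℂ (Set.range (ket : ι → Hilb ι)), P (ketBra u' v) := by
      intro u' hu'
      induction hu' using Submodule.span_induction with
      | mem x hx => obtain ⟨s, rfl⟩ := hx; exact hv s
      | zero => simpa [ketBra] using hzero
      | add x y _ _ hx hy =>
        rw [ketBra_add_left]
        exact hadd _ _ (isTraceClass_ketBra _ _) (isTraceClass_ketBra _ _) hx hy
      | smul c x _ hx =>
        rw [ketBra_smul_left]
        exact hsmul c _ (isTraceClass_ketBra _ _) hx
    refine hlim _ (isTraceClass_ketBra _ _) fun ε hε => ?_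
    obtain ⟨η, hη, hle⟩ := hsmall v ε hε
    obtain ⟨u', hu', hlt⟩ := hdense u η hη
    refine ⟨ketBra u' v, isTraceClass_ketBra _ _, hspan u' hu', ?_⟩
    have : ketBra u v - ketBra u' v = ketBra (u - u') v := by simp [ketBra]
    rw [this]
    refine (traceNorm_ketBra_le _ _).trans (le_trans (mul_le_mul_left ?_ _) hle)
    rw [← ofReal_norm]
    exact ENNReal.ofReal_le_ofReal hlt.le
  have hright : ∀ u : Hilb ι, (∀ t, P (ketBra u (ket t))) → ∀ v, P (ketBra u v) := by
    intro u hu v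
    have hspan : ∀ v' ∈ Submodule.span ℂ (Set.range (ket : ι → Hilb ι)), P (ketBra u v') := by
      intro v' hv'
      induction hv' using Submodule.span_induction with
      | mem x hx => obtain ⟨s, rfl⟩ := hx; exact hu s
      | zero => simpa [ketBra] using hzero
      | add x y _ _ hx hy =>
        rw [ketBra_add_right]
        exact hadd _ _ (isTraceClass_ketBra _ _) (isTraceClass_ketBra _ _) hx hy
      | smul c x _ hx =>
        rw [ketBra_smul_right]
        exact hsmul _ _ (isTraceClass_ketBra _ _) hx
    refine hlim _ (isTraceClass_ketBra _ _) fun ε hε => ?_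
    obtain ⟨η, hη, hle⟩ := hsmall u ε hε
    obtain ⟨v', hv', hlt⟩ := hdense v η hη
    refine ⟨ketBra u v', isTraceClass_ketBra _ _, hspan v' hv', ?_⟩
    have : ketBra u v - ketBra u v' = ketBra u (v - v') := by simp [ketBra]
    rw [this]
    refine (traceNorm_ketBra_le _ _).trans (le_trans ?_ hle)
    rw [mul_comm]
    refine mul_le_mul_left ?_ _
    rw [← ofReal_norm]
    exact ENNReal.ofReal_le_ofReal hlt.le
  have hrank : ∀ u v, P (ketBra u v) := fun u =>
    hright u fun t => hleft (ket t) (fun s => hket s t) u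
  obtain ⟨u, v, hA, hle⟩ := exists_hasAtoms X
  have hfin := ne_top_of_le_ne_top hX hle
  have hsum : ∀ F : Finset ι, IsTraceClass (∑ a ∈ F, ketBra (u a) (v a)) ∧
      P (∑ a ∈ F, ketBra (u a) (v a)) := by
    intro F
    induction F using Finset.induction_on with
    | empty => exact ⟨by simp [IsTraceClass, traceNorm_zero], by simpa using hzero⟩
    | insert a F ha ih =>
      rw [Finset.sum_insert ha]
      exact ⟨(isTraceClass_ketBra _ _).add ih.1,
        hadd _ _ (isTraceClass_ketBra _ _) ih.1 (hrank _ _) ih.2⟩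
  refine hlim X hX fun ε hε => ?_
  have htail := ENNReal.tendsto_tsum_compl_atTop_zero hfin
  obtain ⟨F, hF⟩ := (ENNReal.tendsto_nhds_zero.mp htail ε hε).exists
  refine ⟨∑ a ∈ F, ketBra (u a) (v a), (hsum F).1, (hsum F).2, le_trans ?_ hF⟩
  -- The remainder is decomposed by the atoms outside F, so its trace norm is at most the tail of a
  -- convergent series.
  have hrest : HasAtoms (X - ∑ a ∈ F, ketBra (u a) (v a)) (fun a : {a // a ∉ F} => u a)
      (fun a => v a) := by
    intro x y
    refine (Finset.hasSum_compl_iff (f := fun a => ⟪x, u a⟫_ℂ * ⟪v a, y⟫_ℂ) F).mpr ?_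
    have h1 : ⟪x, (X - ∑ a ∈ F, ketBra (u a) (v a)) y⟫_ℂ +
        ∑ a ∈ F, ⟪x, u a⟫_ℂ * ⟪v a, y⟫_ℂ = ⟪x, X y⟫_ℂ := by
      simp only [sub_apply, sum_apply, inner_sub_right, inner_sum, inner_ketBra, sub_add_cancel]
    rw [h1]
    exact hA x y
  exact hrest.traceNorm_le

/-- The easy direction of Banach–Steinhaus: with a bound C uniform in n, the set where convergence
holds is a trace-norm closed linear subspace. -/
theorem tendsto_traceNorm_of_ketBra {ι : Type} [DecidableEq ι] {Δ : ℕ → Op ι → Op ι} {C : NNReal}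
    (hadd : ∀ n X Y, IsTraceClass X → IsTraceClass Y → Δ n (X + Y) = Δ n X + Δ n Y)
    (hsmul : ∀ n (c : ℂ) X, IsTraceClass X → Δ n (c • X) = c • Δ n X)
    (hbdd : ∀ n X, IsTraceClass X → traceNorm (Δ n X) ≤ C * traceNorm X)
    (hket : ∀ s t : ι,
      Tendsto (fun n => traceNorm (Δ n (ketBra (ket s) (ket t)))) atTop (𝓝 0))
    {X : Op ι} (hX : IsTraceClass X) : Tendsto (fun n => traceNorm (Δ n X)) atTop (𝓝 0) := by
  have hsq : ∀ {f g : ℕ → ℝ≥0∞}, (∀ n, f n ≤ g n) → Tendsto g atTop (𝓝 0) →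
      Tendsto f atTop (𝓝 0) := fun hle hg =>
    tendsto_of_tendsto_of_tendsto_of_le_of_le tendsto_const_nhds hg (fun _ => zero_le) hle
  refine traceClass_induction (P := fun X => Tendsto (fun n => traceNorm (Δ n X)) atTop (𝓝 0))
    ?_ hket ?_ ?_ ?_ X hX
  · refine hsq (g := fun _ => 0) (fun n => ?_) tendsto_const_nhds
    have h0 : IsTraceClass (0 : Op ι) := by simp [IsTraceClass, traceNorm_zero]
    simpa [traceNorm_zero] using hbdd n 0 h0
  · intro X Y hX hY h1 h2
    refine hsq (fun n => ?_) (by simpa using h1.add h2)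
    rw [hadd n X Y hX hY]
    exact traceNorm_add_le _ _
  · intro c X hX h1
    have h2 := ENNReal.Tendsto.const_mul (a := ‖c‖ₑ) h1 (Or.inr enorm_ne_top)
    rw [mul_zero] at h2
    refine hsq (fun n => ?_) h2
    rw [hsmul n c X hX]
    exact traceNorm_smul_le _ _
  · intro X hX happ
    rw [ENNReal.tendsto_nhds_zero]
    intro ε hε
    have hC : ((C : ℝ≥0∞) + 1) ≠ ∞ := by simp
    -- C + 1 replaces C to avoid dividing by zero.
    obtain ⟨Y, hY, hlim, hle⟩ := happ (ε / 2 / (C + 1))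
      (ENNReal.div_pos (ENNReal.half_pos hε.ne').ne' hC)
    filter_upwards [ENNReal.tendsto_nhds_zero.mp hlim (ε / 2) (ENNReal.half_pos hε.ne')] with n hn
    have h1 : Δ n X = Δ n (X - Y) + Δ n Y := by
      rw [← hadd n _ _ (hX.sub hY) hY, sub_add_cancel]
    rw [h1, ← ENNReal.add_halves ε]
    refine (traceNorm_add_le _ _).trans (add_le_add ?_ hn)
    refine (hbdd n _ (hX.sub hY)).trans ?_
    calc (C : ℝ≥0∞) * traceNorm (X - Y) ≤ (C + 1) * (ε / 2 / (C + 1)) :=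
          mul_le_mul' le_self_add hle
      _ ≤ ε / 2 := ENNReal.mul_div_le

/-! ### The limit of the lifted blurring maps -/

theorem isTensorProduct_ketBra {m : ℕ} (s t : Fin m → ℕ) :
    IsTensorProduct (fun i => ketBra (ket (s i)) (ket (t i))) (ketBra (ket s) (ket t)) := by
  intro h k
  have hprod : ∀ p q : Fin m → ℕ, (if p = q then (1 : ℂ) else 0) =
      ∏ i, if p i = q i then (1 : ℂ) else 0 := by
    intro p q
    rw [Fintype.prod_ite_zero]
    simp [funext_iff]
  simp only [inner_ketBra, inner_ket_ket, Finset.prod_mul_distrib, hprod]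

/-- Matrix units are tensor products of one-mode matrix units, so `map_tensor` fixes every entry of
their images. -/
theorem IsTensorPower.eq_on_ketBra {m : ℕ} {Λ : Op ℕ → Op ℕ}
    {Φ Ψ : Op (Fin m → ℕ) → Op (Fin m → ℕ)} (hΦ : IsTensorPower m Λ Φ) (hΨ : IsTensorPower m Λ Ψ)
    (s t : Fin m → ℕ) : Φ (ketBra (ket s) (ket t)) = Ψ (ketBra (ket s) (ket t)) :=
  Op.ext_ket fun h k =>
    (hΦ.map_tensor _ _ (fun _ => isTraceClass_ketBra _ _) (isTensorProduct_ketBra s t) h k).trans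
      (hΨ.map_tensor _ _ (fun _ => isTraceClass_ketBra _ _) (isTensorProduct_ketBra s t) h k).symm

theorem lamParam_mul_muParam_sq {δ : ℝ} (hδ : 0 < δ) :
    lamParam δ * muParam δ ^ 2 = (1 / (1 + δ)) ^ 2 := by
  have h1 : 0 < 1 + δ * (1 + δ) := by positivity
  rw [lamParam, muParam, div_pow, Real.sq_sqrt h1.le]
  field_simp

theorem one_sub_lamParam_mul_muParam_sq {δ : ℝ} (hδ : 0 < δ) :
    (1 - lamParam δ) * muParam δ ^ 2 = δ / (1 + δ) := by
  have h1 : 0 < 1 + δ * (1 + δ) := by positivity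
  rw [lamParam, muParam, div_pow, Real.sq_sqrt h1.le]
  field_simp
  ring

theorem pureLoss_comp_damping {δ : ℝ} (hδ : 0 < δ) :
    pureLoss (lamParam δ) ∘ damping (muParam δ) =
      kraus (shiftOp (lossWeight ((1 / (1 + δ)) ^ 2) (δ / (1 + δ)))) := by
  have h1 : 0 < 1 + δ * (1 + δ) := by positivity
  funext X
  rw [← lamParam_mul_muParam_sq hδ, ← one_sub_lamParam_mul_muParam_sq hδ]
  refine pureLoss_damping_eq_kraus (by unfold lamParam; positivity) ?_
    (by unfold muParam; positivity) ?_ X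
  · rw [lamParam, div_lt_one h1]
    nlinarith
  · rw [muParam, div_le_one (by positivity)]
    exact Real.sqrt_le_iff.mpr ⟨by positivity, by nlinarith⟩

/-- The left side is λμ² + (1-λ)μ² = μ(δ)² = (1+δ+δ²)/(1+δ)². -/
theorem loss_add_le_one {δ : ℝ} (hδ : 0 < δ) : (1 / (1 + δ)) ^ 2 + δ / (1 + δ) ≤ 1 := by
  rw [div_pow, one_pow, div_add_div _ _ (by positivity) (by positivity), div_le_one (by positivity)]
  nlinarith [pow_pos hδ 2, pow_pos hδ 3]

theorem isTensorPower_loss_damping (m : ℕ) {δ : ℝ} (hδ : 0 < δ) :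
    IsTensorPower m (pureLoss (lamParam δ) ∘ damping (muParam δ))
      (kraus (shiftOp fun j h : Fin m → ℕ =>
        ∏ i, lossWeight ((1 / (1 + δ)) ^ 2) (δ / (1 + δ)) (j i) (h i))) := by
  rw [pureLoss_comp_damping hδ]
  exact isTensorPower_kraus (by positivity) (by positivity) (loss_add_le_one hδ) m

theorem stronglyConverges_liftedBlurring {m : ℕ} {δ : ℝ} (hδ : 0 < δ)
    {Φ : Op (Fin m → ℕ) → Op (Fin m → ℕ)}
    (hΦ : IsTensorPower m (pureLoss (lamParam δ) ∘ damping (muParam δ)) Φ) :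
    StronglyConverges (fun n => liftedBlurring m n δ) Φ := by
  intro X hX
  obtain ⟨C, hC⟩ := hΦ.bounded
  have hBl : ∀ n, liftedBlurring m n δ = kraus (mixOp (m := m) (n := n) (r := ⌊δ * n⌋₊)) :=
    fun n => funext (liftedBlurring_eq_kraus m n δ)
  simp only [hBl]
  refine ⟨fun n => isKraus_mixOp.isTraceClass hX,
    ne_top_of_le_ne_top (ENNReal.mul_ne_top ENNReal.coe_ne_top hX) (hC X hX), ?_⟩
  -- 1 bounds the blurring maps for every n, and C bounds Φ.
  refine tendsto_traceNorm_of_ketBra (C := 1 + C)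
    (Δ := fun n X => kraus (mixOp (m := m) (n := n) (r := ⌊δ * n⌋₊)) X - Φ X) ?_ ?_ ?_ ?_ hX
  · intro n X Y hX hY
    rw [isKraus_mixOp.map_add hX hY, hΦ.map_add X Y hX hY]
    abel
  · intro n c X hX
    rw [isKraus_mixOp.map_smul c hX, hΦ.map_smul c X hX, smul_sub]
  · intro n X hX
    refine (traceNorm_sub_le _ _).trans ?_
    push_cast
    rw [add_mul, one_mul]
    exact add_le_add (isKraus_mixOp.traceNorm_le hX) (hC X hX)
  · intro s t
    simp only [hΦ.eq_on_ketBra (isTensorPower_loss_damping m hδ)]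
    exact tendsto_traceNorm_ketBra_ket hδ
      (isLossWeight_pi (by positivity) (by positivity) (loss_add_le_one hδ) m) s t

end

end Blurring

theorem corollary5 (m : ℕ) (δ : ℝ) (hδ : 0 < δ) (hδ' : δ ≤ 1 / 2) :
    (∃ Φ, Blurring.IsTensorPower m
      (Blurring.pureLoss (Blurring.lamParam δ) ∘ Blurring.damping (Blurring.muParam δ)) Φ) ∧
    ∀ Φ, Blurring.IsTensorPower m
        (Blurring.pureLoss (Blurring.lamParam δ) ∘ Blurring.damping (Blurring.muParam δ)) Φ →
      Blurring.StronglyConverges (fun n => Blurring.liftedBlurring m n δ) Φ :=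
  ⟨⟨_, Blurring.isTensorPower_loss_damping m hδ⟩,
    fun _ hΦ => Blurring.stronglyConverges_liftedBlurring hδ hΦ⟩
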